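/- **Setting.** Let $n\ge 1$, let $\Sigma\in\mathcal S^n$ be positive semidefinite, and let $\rho\in\mathcal S^n$ have entries $\rho_{ij}\ge 0$, with $\Sigma+\mathrm{Diag}(\rho)\succ0$, where $\mathrm{Diag}(\rho)$ is the diagonal part of $\rho$. Write $\langle X,Y\rangle=\mathrm{Tr}(XY^T)$, $\|\cdot\|_F$ for the Frobenius norm, $\|\cdot\|$ for the Euclidean operator norm and $\rho*U$ for the entrywise product. Put $\mathcal U=\{U\in\mathcal S^n:|U_{ij}|\le 1\ \forall i,j\}$ and $\phi(X,U)=\log\det X-\langle\Sigma+\rho*U,X\rangle$. The penalized problem is $$\max_{X\succeq0}\ \log\det X-\langle\Sigma,X\rangle-\sum_{i,j}\rho_{ij}|X_{ij}|\qquad(\mathrm{PP}),$$ with $\log\det X=-\infty$ for singular $X$. Let $F$ denote its objective. Let $\alpha_\rho=1/(\|\Sigma\|+\|\rho\|)$, let $\vartheta=\max\{F((\Sigma+\mathrm{Diag}(\rho))^{-1}),\,n(-1-\log\mathrm{Tr}(\Sigma+\rho)+\log n)\}-(n-1)[-1-\log\lambda_{\min}(\Sigma+\mathrm{Diag}(\rho))]$,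 and let $\beta_\rho$ be the largest positive root of $\log t-\lambda_{\min}(\Sigma+\mathrm{Diag}(\rho))\,t-\vartheta=0$. For $\beta\ge\alpha_\rho$ let $$g_{\rho,\beta}(U)=\max_{\alpha_\rho I\preceq X\preceq\beta I}\phi(X,U),$$ let $X_\beta(U)$ be the unique maximizer, let $g_\rho=g_{\rho,\beta_\rho}$, and let $f_\rho(X)=\min_{U\in\mathcal U}\phi(X,U)$. The primal problem is $\max\{f_\rho(X):\alpha_\rho I\preceq X\preceq\beta_\rho I\}$ and the dual problem is $\min\{g_\rho(U):U\in\mathcal U\}$. A feasible point is $\epsilon$-optimal if its objective value is within $\epsilon$ of the optimal value. **SPG method** (for given $\beta$, $\epsilon_o>0$, $\gamma\in(0,1)$, $0<\sigma_1<\sigma_2<1$, $0<\alpha_{\min}<\alpha_{\max}<\infty$, an integer $M\ge1$, and a starting point $U_0\in\mathcal U$). Write $g=g_{\rho,\beta}$, choose any $\alpha_0\in[\alpha_{\min},\alpha_{\max}]$ and set $k=0$. 1. If $g(U_k)-f_\rho(X_\beta(U_k))\le\epsilon_o$, return $U_k$. 2. Let $d_k=P_{\mathcal U}(U_k-\alpha_k\nabla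 g(U_k))-U_k$, where $P_{\mathcal U}$ is the projection onto $\mathcal U$ in the norm $\|\cdot\|_F$. Set $\lambda=1$. While $$g(U_k+\lambda d_k)>\max_{0\le j\le\min\{k,M-1\}}g(U_{k-j})+\gamma\lambda\langle d_k,\nabla g(U_k)\rangle,$$ replace $\lambda$ by any element of $[\sigma_1\lambda,\sigma_2\lambda]$. Then set $U_{k+1}=U_k+\lambda d_k$, $s_k=U_{k+1}-U_k$ and $y_k=\nabla g(U_{k+1})-\nabla g(U_k)$. Set $\alpha_{k+1}=\alpha_{\max}$ if $\langle s_k,y_k\rangle\le0$, and $\alpha_{k+1}=\min\{\alpha_{\max},\max\{\alpha_{\min},\langle s_k,s_k\rangle/\langle s_k,y_k\rangle\}\}$ otherwise. Increase $k$ by one and go to 1. **ASPG method** (for given $\epsilon_o>0$, $\alpha_\rho\le\beta_0\le\beta_\rho$, $r_\beta>1$, $U_0\in\mathcal U$). For $k=0,1,\dots$: set $\beta=\beta_k$ and let $\hat U_k$ be the point returned by the SPG method for this $\beta$ started from $U_0$. If $\beta=\beta_\rho$ or $\lambda_{\max}(X_\beta(\hat U_k))<\beta$, terminate with $\hat U=\hat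 U_k$. Otherwise set $U_0\leftarrow\hat U_k$, $\beta_{k+1}=\min\{\beta r_\beta,\beta_\rho\}$ and continue. **Theorem.** For every $\epsilon_o>0$ and every choice of the above parameters and initial data, and whatever choices of the step lengths $\lambda$ and of the initial $\alpha_0$ of each SPG run are made, the ASPG method is well defined (it can always be continued until it terminates) and terminates after finitely many elementary steps, hence after finitely many total (inner) iterations; the bound $\beta$ is raised only finitely often. At termination, with final bound $\beta$ and point $\hat U$: - $\hat U$ is an $\epsilon_o$-optimal solution of the dual problem, and $X_\beta(\hat U)$ is an $\epsilon_o$-optimal solution of the primal problem and of the penalized problem $(\mathrm{PP})$; - either $\beta=\beta_\rho$ or $\lambda_{\max}(X_\beta(\hat U))<\beta$; - $g_\rho(\hat U)=g_{\rho,\beta}(\hat U)$. -/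

import Mathlib

open scoped Matrix

noncomputable section

namespace ASPG

variable {n : ℕ}

/-- Square real matrices of order `n`. -/
abbrev Mat (n : ℕ) : Type := Matrix (Fin n) (Fin n) ℝ

/-- The standard inner product `⟨X, Y⟩ = Tr (X Yᵀ)`. -/
def ip (X Y : Mat n) : ℝ := (X * Yᵀ).trace

/-- The Frobenius norm `‖X‖_F = √Tr (X Xᵀ)`. -/
def frob (X : Mat n) : ℝ := Real.sqrt ((X * Xᵀ).trace)

/-- The operator norm associated with the Euclidean norm. -/
def opNorm (X : Mat n) : ℝ := ‖Matrix.toEuclideanCLM (n := Fin n) (𝕜 := ℝ) X‖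

/-- The minimal eigenvalue (used for symmetric matrices of positive order). -/
def lamMin (X : Mat n) : ℝ := sInf (spectrum ℝ X)

/-- The maximal eigenvalue (used for symmetric matrices of positive order). -/
def lamMax (X : Mat n) : ℝ := sSup (spectrum ℝ X)

/-- `Diag(ρ)`: the diagonal matrix with the diagonal entries of `ρ`. -/
def diagPart (ρ : Mat n) : Mat n := Matrix.diagonal fun i => ρ i i

/-! ### The penalized problem, the bounds and the primal-dual pair -/

/-- `log det X - ⟨S, X⟩ - ∑ ρ_ij |X_ij|`, meaningful for positive definite `X`. -/
def penaltyVal (S ρ X : Mat n) : ℝ :=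
  Real.log X.det - ip S X - ∑ i, ∑ j, ρ i j * |X i j|

open Classical in
/-- Objective of the penalized problem on the positive semidefinite cone, with the convention
`log det X = -∞` for singular `X`. -/
def penaltyObj (S ρ X : Mat n) : EReal :=
  if X.PosDef then (penaltyVal S ρ X : EReal) else ⊥

/-- The set `𝒰` of symmetric matrices with entries in `[-1, 1]`. -/
def setU (n : ℕ) : Set (Mat n) := {U | U.IsSymm ∧ ∀ i j, |U i j| ≤ 1}

/-- `φ(X, U) = log det X - ⟨S + ρ ∗ U, X⟩`, with `∗` the entrywise product. -/
def phi (S ρ X U : Mat n) : ℝ := Real.log X.det - ip (S + Matrix.hadamard ρ U) X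

/-- The lower bound `α_ρ = 1 / (‖S‖ + ‖ρ‖)`. -/
def alphaRho (S ρ : Mat n) : ℝ := 1 / (opNorm S + opNorm ρ)

/-- `θ = n (-1 - log Tr (S + ρ) + log n)`. -/
def theta (S ρ : Mat n) : ℝ := (n : ℝ) * (-1 - Real.log (S + ρ).trace + Real.log (n : ℝ))

/-- `ϑ = max {f_ρ((S + Diag ρ)⁻¹), θ} - (n - 1) (-1 - log λ_min(S + Diag ρ))`. -/
def vartheta (S ρ : Mat n) : ℝ :=
  max (penaltyVal S ρ (S + diagPart ρ)⁻¹) (theta S ρ)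
    - ((n : ℝ) - 1) * (-1 - Real.log (lamMin (S + diagPart ρ)))

/-- The upper bound `β_ρ`: the largest positive root of
`log t - λ_min(S + Diag ρ) t - ϑ = 0` (there are one or two roots). -/
def betaRho (S ρ : Mat n) : ℝ :=
  sSup {t : ℝ | 0 < t ∧ Real.log t - lamMin (S + diagPart ρ) * t - vartheta S ρ = 0}

/-- `{X symmetric : α_ρ I ⪯ X ⪯ β I}`. -/
def box (S ρ : Mat n) (β : ℝ) : Set (Mat n) :=
  {X | X.IsSymm ∧ (X - alphaRho S ρ • (1 : Mat n)).PosSemidef ∧ (β • (1 : Mat n) - X).PosSemidef}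

/-- `𝒳_ρ = {X symmetric : α_ρ I ⪯ X ⪯ β_ρ I}`. -/
def setX (S ρ : Mat n) : Set (Mat n) := box S ρ (betaRho S ρ)

/-- The primal objective `f_ρ(X) = min_{U ∈ 𝒰} φ(X, U)`. -/
def fRho (S ρ X : Mat n) : ℝ := sInf ((fun U => phi S ρ X U) '' setU n)

/-- `g_{ρ,β}(U) = max_{α_ρ I ⪯ X ⪯ β I} φ(X, U)`. -/
def gBeta (S ρ : Mat n) (β : ℝ) (U : Mat n) : ℝ := sSup ((fun X => phi S ρ X U) '' box S ρ β)

/-- The dual objective `g_ρ(U) = max_{X ∈ 𝒳_ρ} φ(X, U)`. -/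
def gRho (S ρ U : Mat n) : ℝ := sSup ((fun X => phi S ρ X U) '' setX S ρ)

/-- `X` solves the maximization problem that defines `g_{ρ,β}(U)`. -/
def IsInnerSol (S ρ : Mat n) (β : ℝ) (U X : Mat n) : Prop :=
  X ∈ box S ρ β ∧ ∀ Y ∈ box S ρ β, phi S ρ Y U ≤ phi S ρ X U

/-- `X_β(U)`: the solution of the maximization problem that defines `g_{ρ,β}(U)`
(it exists and is unique for `β ≥ α_ρ`). -/
def Xopt (S ρ : Mat n) (β : ℝ) (U : Mat n) : Mat n := Classical.epsilon (IsInnerSol S ρ β U)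

/-- The gradient of a function on matrices, as the matrix of its partial derivatives. -/
def grad (g : Mat n → ℝ) (U : Mat n) : Mat n :=
  Matrix.of fun i j => lineDeriv ℝ g U (Matrix.single i j 1)

/-- The projection onto `𝒰` in the Frobenius norm. -/
def projU (A : Mat n) : Mat n :=
  Classical.epsilon fun V => V ∈ setU n ∧ ∀ W ∈ setU n, frob (V - A) ≤ frob (W - A)

/-- `x` is an `ε`-optimal solution of `max {f y : y ∈ s}`. -/
def IsEpsMax {E : Type*} (f : E → EReal) (s : Set E) (ε : ℝ) (x : E) : Prop :=
  x ∈ s ∧ ∀ y ∈ s, f y ≤ f x + (ε : EReal)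

/-- `x` is an `ε`-optimal solution of `min {g y : y ∈ s}`. -/
def IsEpsMin {E : Type*} (g : E → ℝ) (s : Set E) (ε : ℝ) (x : E) : Prop :=
  x ∈ s ∧ ∀ y ∈ s, g x ≤ g y + ε

/-! ### The SPG and ASPG methods -/

/-- The parameters of the spectral projected gradient (SPG) method. -/
structure SPGParams where
  γ : ℝ
  σ₁ : ℝ
  σ₂ : ℝ
  αmin : ℝ
  αmax : ℝ
  M : ℕ
  γ_pos : 0 < γ
  γ_lt : γ < 1
  σ₁_pos : 0 < σ₁
  σ₁_lt : σ₁ < σ₂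
  σ₂_lt : σ₂ < 1
  αmin_pos : 0 < αmin
  αmin_lt : αmin < αmax
  one_le_M : 1 ≤ M

/-- `g^M_k = max {g(U_{k-j}) : 0 ≤ j ≤ min {k, M - 1}}`. -/
def gMax (g : Mat n → ℝ) (M k : ℕ) (U : ℕ → Mat n) : ℝ :=
  (Finset.range (min k (M - 1) + 1)).sup' ⟨0, by simp⟩ fun j => g (U (k - j))

/-- The search direction `d = P_𝒰(U - α ∇g(U)) - U`. -/
def direction (g : Mat n → ℝ) (U : Mat n) (α : ℝ) : Mat n := projU (U - α • grad g U) - U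

/-- The spectral step length computed from two successive iterates `U` and `V`. -/
def nextAlpha (p : SPGParams) (g : Mat n → ℝ) (U V : Mat n) : ℝ :=
  let s := V - U
  let y := grad g V - grad g U
  if ip s y ≤ 0 then p.αmax else min p.αmax (max p.αmin (ip s s / ip s y))

/-- The acceptance test of the nonmonotone line search at the `k`-th iterate, for the
trial length `lam`. -/
def Accepts (p : SPGParams) (g : Mat n → ℝ) (k : ℕ) (U : ℕ → Mat n) (α lam : ℝ) : Prop :=
  g (U k + lam • direction g (U k) α) ≤
    gMax g p.M k U + p.γ * lam * ip (direction g (U k) α) (grad g (U k))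

/-- Control states of the adaptive method. Everywhere `m` is the number of times that the bound
has been raised and `β` is the current bound `β_m`.
* `test m β k U α`: the current SPG run has computed `U 0, …, U k` and the step length `α_k = α`,
  and is about to test its termination criterion;
* `search m β k U α lam`: its line search is about to test the trial length `lam`;
* `returned m β Uhat`: the SPG run with bound `β` has returned `Uhat`;
* `done m β Uhat`: the adaptive method has terminated. -/
inductive State (n : ℕ) : Type
  | test (m : ℕ) (β : ℝ) (k : ℕ) (U : ℕ → Mat n) (α : ℝ) : State n
  | search (m : ℕ) (β : ℝ) (k : ℕ) (U : ℕ → Mat n) (α lam : ℝ) : State n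
  | returned (m : ℕ) (β : ℝ) (Uhat : Mat n) : State n
  | done (m : ℕ) (β : ℝ) (Uhat : Mat n) : State n

/-- The number of times that the bound has been raised so far. -/
def State.raises : State n → ℕ
  | .test m _ _ _ _ => m
  | .search m _ _ _ _ _ => m
  | .returned m _ _ => m
  | .done m _ _ => m

/-- One elementary step of the adaptive method. It is a relation, since the method leaves open
the choice of the reduced trial lengths and of the initial step length of each SPG run. -/
inductive Step (S ρ : Mat n) (ε : ℝ) (p : SPGParams) (r : ℝ) : State n → State n → Prop
  | testPass (m : ℕ) (β : ℝ) (k : ℕ) (U : ℕ → Mat n) (α : ℝ)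
      (h : gBeta S ρ β (U k) - fRho S ρ (Xopt S ρ β (U k)) ≤ ε) :
      Step S ρ ε p r (.test m β k U α) (.returned m β (U k))
  | testFail (m : ℕ) (β : ℝ) (k : ℕ) (U : ℕ → Mat n) (α : ℝ)
      (h : ¬ gBeta S ρ β (U k) - fRho S ρ (Xopt S ρ β (U k)) ≤ ε) :
      Step S ρ ε p r (.test m β k U α) (.search m β k U α 1)
  | accept (m : ℕ) (β : ℝ) (k : ℕ) (U : ℕ → Mat n) (α lam : ℝ) (V : Mat n)
      (h : Accepts p (gBeta S ρ β) k U α lam)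
      (hV : V = U k + lam • direction (gBeta S ρ β) (U k) α) :
      Step S ρ ε p r (.search m β k U α lam)
        (.test m β (k + 1) (Function.update U (k + 1) V) (nextAlpha p (gBeta S ρ β) (U k) V))
  | backtrack (m : ℕ) (β : ℝ) (k : ℕ) (U : ℕ → Mat n) (α lam lam' : ℝ)
      (h : ¬ Accepts p (gBeta S ρ β) k U α lam)
      (hlam : lam' ∈ Set.Icc (p.σ₁ * lam) (p.σ₂ * lam)) :
      Step S ρ ε p r (.search m β k U α lam) (.search m β k U α lam')
  | finish (m : ℕ) (β : ℝ) (Uhat : Mat n)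
      (h : β = betaRho S ρ ∨ lamMax (Xopt S ρ β Uhat) < β) :
      Step S ρ ε p r (.returned m β Uhat) (.done m β Uhat)
  | raise (m : ℕ) (β : ℝ) (Uhat : Mat n) (α : ℝ)
      (h : ¬ (β = betaRho S ρ ∨ lamMax (Xopt S ρ β Uhat) < β))
      (hα : α ∈ Set.Icc p.αmin p.αmax) :
      Step S ρ ε p r (.returned m β Uhat)
        (.test (m + 1) (min (β * r) (betaRho S ρ)) 0 (fun _ => Uhat) α)

/-- The initial state, for the initial bound `β₀`, the starting point `U₀` and the initial step
length `α₀`. -/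
def initState (β₀ : ℝ) (U₀ : Mat n) (α₀ : ℝ) : State n := .test 0 β₀ 0 (fun _ => U₀) α₀

/-- `s` occurs in some execution of the adaptive method. -/
def Reachable (S ρ : Mat n) (ε : ℝ) (p : SPGParams) (r β₀ : ℝ) (U₀ : Mat n) (α₀ : ℝ)
    (s : State n) : Prop :=
  Relation.ReflTransGen (Step S ρ ε p r) (initState β₀ U₀ α₀) s

end ASPG

end

/-!
The adaptive method terminates because the dual objective `g = g_{ρ,β}` is convex and differentiable
with a uniformly continuous gradient. The function `log det` is strictly concave on positive definite
matrices (`log_det_le`, `log_det_lt`, which reduce to `log t ≤ t - 1` on eigenvalues), so on the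
compact box the inner maximizer `X_β(U)` is uniformly continuous in `U` (`xopt_uniformContinuous`), and
`∇g(U) = -(ρ ∗ X_β(U))` (`grad_gBeta`). The duality gap at `U` is `⟨U - W, ∇g(U)⟩` for some feasible
`W` (`exists_gap_eq`); by the variational inequality of the projection, the search directions stay
away from `0` as long as the gap exceeds `ε` (`exists_le_frob_direction`). Convexity and the uniform
continuity of `∇g` then give a length below which every trial step is accepted (`exists_accepts`),
hence a fixed decrease relative to the nonmonotone reference value in every iteration
(`exists_decrease`). Since `g` is bounded below on the feasible set, an SPG run is finite (`acc_test`).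
The bound after `m` raises is `min (β₀ r ^ m) β_ρ`, so there are finitely many runs. All this is
expressed as accessibility of the initial state for the reversed step relation (`acc_initState`),
together with an invariant of the executions (`Inv`) that also excludes stuck states.

At termination the gap is at most `ε`. If the upper constraint of the inner problem is inactive, then
concavity makes `X_β(U)` maximal over the largest box as well (`IsInnerSol.of_lamMax_lt`), so that
`g_ρ(U) = g_{ρ,β}(U)`, and weak duality gives the optimality for the primal-dual pair. For the
penalized problem one needs in addition that no positive definite matrix beats the primal optimum
(`exists_mem_setX`). A maximizer over a sufficiently large Loewner interval is compared with two
reference points, which bounds its eigenvalues by `β_ρ` (`eigenvalues_le_betaRho`); if an eigenvalue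
were below `α_ρ`, adding `t v vᵀ` with its eigenvector `v` would raise `log det` by `t / (λ + t)` at
the cost of at most `t / α_ρ` (`alphaRho_le_eigenvalues`). No dual solution is involved.
-/

open scoped Matrix

namespace ASPG

variable {n : ℕ}

/-! ### The trace inner product and quadratic forms -/

lemma ip_eq_sum (X Y : Mat n) : ip X Y = ∑ i, ∑ j, X i j * Y i j := by
  simp [ip, Matrix.trace, Matrix.mul_apply]

lemma ip_comm (X Y : Mat n) : ip X Y = ip Y X := by
  simp [ip_eq_sum, mul_comm]

lemma ip_add_left (X Y Z : Mat n) : ip (X + Y) Z = ip X Z + ip Y Z := by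
  simp [ip, add_mul]

lemma ip_sub_left (X Y Z : Mat n) : ip (X - Y) Z = ip X Z - ip Y Z := by
  simp [ip, sub_mul]

lemma ip_smul_left (c : ℝ) (X Z : Mat n) : ip (c • X) Z = c * ip X Z := by
  simp [ip]

lemma ip_add_right (X Y Z : Mat n) : ip X (Y + Z) = ip X Y + ip X Z := by
  simp [ip, mul_add]

lemma ip_sub_right (X Y Z : Mat n) : ip X (Y - Z) = ip X Y - ip X Z := by
  simp [ip, mul_sub]

lemma ip_smul_right (c : ℝ) (X Z : Mat n) : ip X (c • Z) = c * ip X Z := by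
  simp [ip]

lemma ip_neg_right (X Z : Mat n) : ip X (-Z) = - ip X Z := by
  simp [ip]

lemma ip_self_nonneg (X : Mat n) : 0 ≤ ip X X := by
  rw [ip_eq_sum]
  exact Finset.sum_nonneg fun i _ => Finset.sum_nonneg fun j _ => mul_self_nonneg _

lemma frob_nonneg (X : Mat n) : 0 ≤ frob X := Real.sqrt_nonneg _

lemma frob_sq (X : Mat n) : frob X ^ 2 = ip X X := Real.sq_sqrt (ip_self_nonneg X)

lemma abs_ip_le (X Y : Mat n) : |ip X Y| ≤ frob X * frob Y := by
  have h := Finset.sum_mul_sq_le_sq_mul_sq (Finset.univ ×ˢ Finset.univ)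
    (fun q : Fin n × Fin n => X q.1 q.2) (fun q : Fin n × Fin n => Y q.1 q.2)
  simp only [Finset.sum_product, sq (X _ _), sq (Y _ _)] at h
  rw [← ip_eq_sum, ← ip_eq_sum, ← ip_eq_sum, ← frob_sq, ← frob_sq, ← mul_pow] at h
  exact abs_le_of_sq_le_sq h (mul_nonneg (frob_nonneg X) (frob_nonneg Y))

lemma frob_neg (X : Mat n) : frob (-X) = frob X := by simp [frob]

lemma ip_hadamard_left (ρ A B : Mat n) : ip (ρ ⊙ A) B = ip A (ρ ⊙ B) := by
  simp only [ip_eq_sum, Matrix.hadamard_apply]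
  exact Finset.sum_congr rfl fun i _ => Finset.sum_congr rfl fun j _ => by ring

lemma ip_single_left (i j : Fin n) (X : Mat n) : ip (Matrix.single i j 1) X = X i j := by
  simp [ip_eq_sum, Matrix.single_apply, ite_and]

lemma ip_vecMulVec (X : Mat n) (v : Fin n → ℝ) :
    ip X (Matrix.vecMulVec v v) = v ⬝ᵥ X *ᵥ v := by
  simp only [ip_eq_sum, Matrix.vecMulVec_apply, dotProduct, Matrix.mulVec, Finset.mul_sum]
  exact Finset.sum_congr rfl fun i _ => Finset.sum_congr rfl fun j _ => by ring

lemma frob_hadamard_le (ρ A : Mat n) : frob (ρ ⊙ A) ≤ frob ρ * frob A := by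
  apply abs_le_of_sq_le_sq' _ (mul_nonneg (frob_nonneg _) (frob_nonneg _)) |>.2
  rw [mul_pow, frob_sq, frob_sq, frob_sq, ip_eq_sum, ip_eq_sum ρ, Finset.sum_mul]
  refine Finset.sum_le_sum fun i _ => ?_
  rw [Finset.sum_mul]
  refine Finset.sum_le_sum fun j _ => ?_
  have h : A i j * A i j ≤ ip A A := by
    rw [ip_eq_sum]
    exact (Finset.single_le_sum (f := fun j => A i j * A i j)
      (fun j _ => mul_self_nonneg _) (Finset.mem_univ j)).trans
      (Finset.single_le_sum (f := fun i => ∑ j, A i j * A i j)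
        (fun i _ => Finset.sum_nonneg fun j _ => mul_self_nonneg _) (Finset.mem_univ i))
  calc (ρ ⊙ A) i j * (ρ ⊙ A) i j = (ρ i j * ρ i j) * (A i j * A i j) := by
        simp only [Matrix.hadamard_apply]; ring
    _ ≤ _ := mul_le_mul_of_nonneg_left h (mul_self_nonneg _)

lemma psd_iff {X : Mat n} : X.PosSemidef ↔ X.IsSymm ∧ ∀ v : Fin n → ℝ, 0 ≤ v ⬝ᵥ X *ᵥ v := by
  rw [Matrix.posSemidef_iff_dotProduct_mulVec, Matrix.IsHermitian,
    Matrix.conjTranspose_eq_transpose_of_trivial]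
  rfl

lemma posDef_iff {X : Mat n} :
    X.PosDef ↔ X.IsSymm ∧ ∀ v : Fin n → ℝ, v ≠ 0 → 0 < v ⬝ᵥ X *ᵥ v := by
  rw [Matrix.posDef_iff_dotProduct_mulVec, Matrix.IsHermitian,
    Matrix.conjTranspose_eq_transpose_of_trivial]
  rfl

lemma isSymm_of_posDef {X : Mat n} (h : X.PosDef) : X.IsSymm := (posDef_iff.1 h).1

/-- The product of two positive semidefinite matrices has a nonnegative trace. -/
lemma ip_nonneg {A B : Mat n} (hA : A.PosSemidef) (hB : B.PosSemidef) : 0 ≤ ip A B := by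
  open scoped MatrixOrder in
  obtain ⟨C, hC⟩ := CStarAlgebra.nonneg_iff_eq_star_mul_self.mp hB.nonneg
  rw [ip, (psd_iff.1 hB).1.eq, hC, Matrix.star_eq_conjTranspose, ← mul_assoc, Matrix.trace_mul_comm,
    ← mul_assoc]
  exact (hA.mul_mul_conjTranspose_same C).trace_nonneg

lemma dotProduct_self_nonneg' (v : Fin n → ℝ) : 0 ≤ v ⬝ᵥ v :=
  Finset.sum_nonneg fun i _ => mul_self_nonneg (v i)

lemma quad_sub_smul_one (X : Mat n) (a : ℝ) (v : Fin n → ℝ) :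
    v ⬝ᵥ (X - a • (1 : Mat n)) *ᵥ v = v ⬝ᵥ X *ᵥ v - a * (v ⬝ᵥ v) := by
  simp [Matrix.sub_mulVec, dotProduct_sub, Matrix.smul_mulVec]

lemma quad_smul_one_sub (X : Mat n) (a : ℝ) (v : Fin n → ℝ) :
    v ⬝ᵥ (a • (1 : Mat n) - X) *ᵥ v = a * (v ⬝ᵥ v) - v ⬝ᵥ X *ᵥ v := by
  simp [Matrix.sub_mulVec, dotProduct_sub, Matrix.smul_mulVec]

lemma smul_one_isSymm (a : ℝ) : (a • (1 : Mat n)).IsSymm := Matrix.isSymm_one.smul a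

/-- `a I ⪯ X`, expressed by the quadratic form of `X`. -/
lemma psd_sub_smul_one_iff {X : Mat n} (hX : X.IsSymm) (a : ℝ) :
    (X - a • (1 : Mat n)).PosSemidef ↔ ∀ v, a * (v ⬝ᵥ v) ≤ v ⬝ᵥ X *ᵥ v := by
  simp only [psd_iff, quad_sub_smul_one, sub_nonneg, and_iff_right_iff_imp]
  exact fun _ => hX.sub (smul_one_isSymm a)

/-- `X ⪯ a I`, expressed by the quadratic form of `X`. -/
lemma psd_smul_one_sub_iff {X : Mat n} (hX : X.IsSymm) (a : ℝ) :
    (a • (1 : Mat n) - X).PosSemidef ↔ ∀ v, v ⬝ᵥ X *ᵥ v ≤ a * (v ⬝ᵥ v) := by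
  simp only [psd_iff, quad_smul_one_sub, sub_nonneg, and_iff_right_iff_imp]
  exact fun _ => (smul_one_isSymm a).sub hX

lemma posDef_of_quad {X : Mat n} (hX : X.IsSymm) {a : ℝ} (ha : 0 < a)
    (h : ∀ v, a * (v ⬝ᵥ v) ≤ v ⬝ᵥ X *ᵥ v) : X.PosDef := by
  refine posDef_iff.2 ⟨hX, fun v hv => (mul_pos ha ?_).trans_le (h v)⟩
  exact lt_of_le_of_ne (dotProduct_self_nonneg' v) fun h0 => hv (dotProduct_self_eq_zero.1 h0.symm)

/-! ### Eigenvalue bounds -/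

lemma psd_sub_smul_one_of_eigenvalues {X : Mat n} (hX : X.IsHermitian) {a : ℝ}
    (h : ∀ i, a ≤ hX.eigenvalues i) : (X - a • (1 : Mat n)).PosSemidef := by
  have hd : X - a • (1 : Mat n) = Unitary.conjStarAlgAut ℝ (Mat n) hX.eigenvectorUnitary
      (Matrix.diagonal fun i => hX.eigenvalues i - a) := by
    have : (Matrix.diagonal fun i => hX.eigenvalues i - a)
        = Matrix.diagonal (RCLike.ofReal ∘ hX.eigenvalues) - a • (1 : Mat n) := by
      ext i j
      by_cases hij : i = j <;> simp [Matrix.diagonal, hij]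
    rw [this, map_sub, ← hX.spectral_theorem, map_smul, map_one]
  rw [hd, Unitary.conjStarAlgAut_apply]
  exact (Matrix.PosSemidef.diagonal fun i => sub_nonneg.2 (h i)).mul_mul_conjTranspose_same _

lemma psd_smul_one_sub_of_eigenvalues {X : Mat n} (hX : X.IsHermitian) {a : ℝ}
    (h : ∀ i, hX.eigenvalues i ≤ a) : (a • (1 : Mat n) - X).PosSemidef := by
  have hd : a • (1 : Mat n) - X = Unitary.conjStarAlgAut ℝ (Mat n) hX.eigenvectorUnitary
      (Matrix.diagonal fun i => a - hX.eigenvalues i) := by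
    have : (Matrix.diagonal fun i => a - hX.eigenvalues i)
        = a • (1 : Mat n) - Matrix.diagonal (RCLike.ofReal ∘ hX.eigenvalues) := by
      ext i j
      by_cases hij : i = j <;> simp [Matrix.diagonal, hij]
    rw [this, map_sub, ← hX.spectral_theorem, map_smul, map_one]
  rw [hd, Unitary.conjStarAlgAut_apply]
  exact (Matrix.PosSemidef.diagonal fun i => sub_nonneg.2 (h i)).mul_mul_conjTranspose_same _

lemma le_lamMax {X : Mat n} (hX : X.IsHermitian) (i : Fin n) : hX.eigenvalues i ≤ lamMax X :=
  le_csSup X.finite_real_spectrum.bddAbove (hX.eigenvalues_mem_spectrum_real i)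

lemma lamMin_le {X : Mat n} (hX : X.IsHermitian) (i : Fin n) : lamMin X ≤ hX.eigenvalues i :=
  csInf_le X.finite_real_spectrum.bddBelow (hX.eigenvalues_mem_spectrum_real i)

lemma lamMin_pos (hn : 0 < n) {X : Mat n} (hX : X.PosDef) : 0 < lamMin X := by
  have hne : (spectrum ℝ X).Nonempty := ⟨_, hX.1.eigenvalues_mem_spectrum_real ⟨0, hn⟩⟩
  have := hne.csInf_mem X.finite_real_spectrum
  rw [hX.1.spectrum_real_eq_range_eigenvalues] at this
  obtain ⟨i, hi⟩ := this
  rw [lamMin, hX.1.spectrum_real_eq_range_eigenvalues, ← hi]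
  exact hX.eigenvalues_pos i

/-! ### Concavity of the logarithm of the determinant -/

lemma log_det_eq_sum {M : Mat n} (hM : M.PosDef) :
    Real.log M.det = ∑ i, Real.log (hM.1.eigenvalues i) := by
  rw [hM.1.det_eq_prod_eigenvalues]
  exact Real.log_prod fun i _ => (hM.eigenvalues_pos i).ne'

lemma eq_one_of_eigenvalues {M : Mat n} (hM : M.IsHermitian) (h : ∀ i, hM.eigenvalues i = 1) :
    M = 1 := by
  have h1 : (RCLike.ofReal ∘ hM.eigenvalues : Fin n → ℝ) = 1 := by
    funext i; simp [h i]
  rw [hM.spectral_theorem, h1]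
  simp

lemma log_det_le_trace {M : Mat n} (hM : M.PosDef) : Real.log M.det ≤ M.trace - n := by
  have h : ∑ i, Real.log (hM.1.eigenvalues i) ≤ ∑ i, (hM.1.eigenvalues i - 1) :=
    Finset.sum_le_sum fun i _ => Real.log_le_sub_one_of_pos (hM.eigenvalues_pos i)
  rw [log_det_eq_sum hM, hM.1.trace_eq_sum_eigenvalues]
  simpa using h

lemma log_det_lt_trace {M : Mat n} (hM : M.PosDef) (h1 : M ≠ 1) :
    Real.log M.det < M.trace - n := by
  have : ∃ i, hM.1.eigenvalues i ≠ 1 := by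
    by_contra! h
    exact h1 (eq_one_of_eigenvalues hM.1 h)
  obtain ⟨i, hi⟩ := this
  have h : ∑ i, Real.log (hM.1.eigenvalues i) < ∑ i, (hM.1.eigenvalues i - 1) :=
    Finset.sum_lt_sum (fun i _ => Real.log_le_sub_one_of_pos (hM.eigenvalues_pos i))
      ⟨i, Finset.mem_univ i, Real.log_lt_sub_one_of_pos (hM.eigenvalues_pos i) hi⟩
  rw [log_det_eq_sum hM, hM.1.trace_eq_sum_eigenvalues]
  simpa using h

/-- Congruence by a factor `B` of `X = Bᵀ B` turns the pair `(X, Y)` into `(1, M)`. -/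
lemma exists_whitening {X Y : Mat n} (hX : X.PosDef) (hY : Y.PosDef) :
    ∃ M : Mat n, M.PosDef ∧ M.det = Y.det / X.det ∧ M.trace = (X⁻¹ * Y).trace ∧
      (M = 1 → Y = X) := by
  open scoped MatrixOrder in
  obtain ⟨B, hB⟩ := CStarAlgebra.nonneg_iff_eq_star_mul_self.mp hX.posSemidef.nonneg
  have hdet : IsUnit X.det := hX.det_pos.ne'.isUnit
  rw [Matrix.star_eq_conjTranspose] at hB
  have hBd : IsUnit B.det := by
    have : X.det = B.det * B.det := by rw [hB]; simp
    rw [this] at hdet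
    exact isUnit_of_mul_isUnit_left hdet
  have hBu : IsUnit B := (Matrix.isUnit_iff_isUnit_det B).2 hBd
  have hBu' : IsUnit B⁻¹ := Matrix.isUnit_nonsing_inv_iff.2 hBu
  have hBH : (B⁻¹)ᴴ * Bᴴ = 1 := by
    rw [← Matrix.conjTranspose_mul, Matrix.mul_nonsing_inv _ hBd, Matrix.conjTranspose_one]
  have hBH' : Bᴴ * (B⁻¹)ᴴ = 1 := by
    rw [← Matrix.conjTranspose_mul, Matrix.nonsing_inv_mul _ hBd, Matrix.conjTranspose_one]
  refine ⟨(B⁻¹)ᴴ * Y * B⁻¹, (Matrix.IsUnit.posDef_star_left_conjugate_iff hBu').2 hY, ?_, ?_, ?_⟩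
  · rw [hB]
    have := hBd.ne_zero
    simp [Matrix.det_nonsing_inv]
    field_simp
  · rw [Matrix.trace_mul_comm, ← mul_assoc, hB, Matrix.mul_inv_rev,
      Matrix.conjTranspose_nonsing_inv]
  · intro h
    calc Y = (Bᴴ * (B⁻¹)ᴴ) * Y * (B⁻¹ * B) := by
          rw [hBH', Matrix.nonsing_inv_mul _ hBd]; simp
      _ = Bᴴ * ((B⁻¹)ᴴ * Y * B⁻¹) * B := by simp only [mul_assoc]
      _ = X := by rw [h, hB, mul_one]

/-- The tangent inequality of the concave function `log det` at `X`. -/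
lemma log_det_le {X Y : Mat n} (hX : X.PosDef) (hY : Y.PosDef) :
    Real.log Y.det ≤ Real.log X.det + ((X⁻¹ * Y).trace - n) := by
  obtain ⟨M, hM, hd, ht, -⟩ := exists_whitening hX hY
  have := log_det_le_trace hM
  rw [hd, ht, Real.log_div hY.det_pos.ne' hX.det_pos.ne'] at this
  linarith

lemma log_det_lt {X Y : Mat n} (hX : X.PosDef) (hY : Y.PosDef) (hne : Y ≠ X) :
    Real.log Y.det < Real.log X.det + ((X⁻¹ * Y).trace - n) := by
  obtain ⟨M, hM, hd, ht, h1⟩ := exists_whitening hX hY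
  have := log_det_lt_trace hM fun h => hne (h1 h)
  rw [hd, ht, Real.log_div hY.det_pos.ne' hX.det_pos.ne'] at this
  linarith

lemma trace_inv_mul_self {X : Mat n} (hX : X.PosDef) : (X⁻¹ * X).trace = n := by
  rw [Matrix.nonsing_inv_mul _ hX.det_pos.ne'.isUnit]
  simp

lemma log_det_concave {X Y : Mat n} (hX : X.PosDef) (hY : Y.PosDef) {s t : ℝ} (hs : 0 < s)
    (ht : 0 < t) (hst : s + t = 1) :
    s * Real.log X.det + t * Real.log Y.det ≤ Real.log (s • X + t • Y).det := by
  have hZ : (s • X + t • Y).PosDef := (hX.smul hs).add (hY.smul ht)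
  have h1 := mul_le_mul_of_nonneg_left (log_det_le hZ hX) hs.le
  have h2 := mul_le_mul_of_nonneg_left (log_det_le hZ hY) ht.le
  have h3 := trace_inv_mul_self hZ
  rw [mul_add, Matrix.trace_add, Matrix.mul_smul, Matrix.mul_smul, Matrix.trace_smul,
    Matrix.trace_smul, smul_eq_mul, smul_eq_mul] at h3
  obtain rfl : t = 1 - s := by linarith
  nlinarith

lemma log_det_midpoint_lt {X Y : Mat n} (hX : X.PosDef) (hY : Y.PosDef) (hne : X ≠ Y) :
    Real.log X.det + Real.log Y.det < 2 * Real.log ((1 / 2 : ℝ) • (X + Y)).det := by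
  have hZ : ((1 / 2 : ℝ) • (X + Y)).PosDef := (hX.add hY).smul (by norm_num)
  have hXZ : X ≠ (1 / 2 : ℝ) • (X + Y) := by
    intro h
    apply hne
    ext i j
    have := congrFun (congrFun h i) j
    simp at this
    linarith
  have h1 := log_det_lt hZ hX hXZ
  have h2 := log_det_le hZ hY
  have h3 := trace_inv_mul_self hZ
  rw [Matrix.mul_smul, mul_add, Matrix.trace_smul, Matrix.trace_add, smul_eq_mul] at h3
  linarith

/-! ### The inner maximization problem -/

/-- The Loewner interval `{X symmetric : a I ⪯ X ⪯ b I}`. The set `box S ρ b` is the case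
`a = alphaRho S ρ`; other lower ends serve to bound the solutions of the penalized problem. -/
def loewnerIcc (n : ℕ) (a b : ℝ) : Set (Mat n) :=
  {X | X.IsSymm ∧ (X - a • (1 : Mat n)).PosSemidef ∧ (b • (1 : Mat n) - X).PosSemidef}

lemma mem_loewnerIcc {a b : ℝ} {X : Mat n} : X ∈ loewnerIcc n a b ↔
    X.IsSymm ∧ (∀ v, a * (v ⬝ᵥ v) ≤ v ⬝ᵥ X *ᵥ v) ∧ ∀ v, v ⬝ᵥ X *ᵥ v ≤ b * (v ⬝ᵥ v) := by
  refine and_congr_right fun h => ?_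
  rw [psd_sub_smul_one_iff h, psd_smul_one_sub_iff h]

lemma loewnerIcc_subset {a b a' b' : ℝ} (ha : a' ≤ a) (hb : b ≤ b') :
    loewnerIcc n a b ⊆ loewnerIcc n a' b' := by
  intro X hX
  rw [mem_loewnerIcc] at hX ⊢
  exact ⟨hX.1,
    fun v => (mul_le_mul_of_nonneg_right ha (dotProduct_self_nonneg' v)).trans (hX.2.1 v),
    fun v => (hX.2.2 v).trans (mul_le_mul_of_nonneg_right hb (dotProduct_self_nonneg' v))⟩

lemma smul_one_mem_loewnerIcc {a b t : ℝ} (ha : a ≤ t) (hb : t ≤ b) :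
    t • (1 : Mat n) ∈ loewnerIcc n a b := by
  refine mem_loewnerIcc.2 ⟨smul_one_isSymm t, fun v => ?_, fun v => ?_⟩ <;>
  · simp only [Matrix.smul_mulVec, Matrix.one_mulVec, dotProduct_smul, smul_eq_mul]
    exact mul_le_mul_of_nonneg_right ‹_› (dotProduct_self_nonneg' v)

lemma posDef_of_mem {a b : ℝ} (ha : 0 < a) {X : Mat n} (hX : X ∈ loewnerIcc n a b) :
    X.PosDef :=
  posDef_of_quad hX.1 ha (mem_loewnerIcc.1 hX).2.1

lemma loewnerIcc_convex {a b : ℝ} {X Y : Mat n} (hX : X ∈ loewnerIcc n a b)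
    (hY : Y ∈ loewnerIcc n a b) {s t : ℝ} (hs : 0 ≤ s) (ht : 0 ≤ t) (hst : s + t = 1) :
    s • X + t • Y ∈ loewnerIcc n a b := by
  rw [mem_loewnerIcc] at *
  have hq : ∀ v : Fin n → ℝ, v ⬝ᵥ (s • X + t • Y) *ᵥ v
      = s * (v ⬝ᵥ X *ᵥ v) + t * (v ⬝ᵥ Y *ᵥ v) := by
    intro v
    simp [Matrix.add_mulVec, Matrix.smul_mulVec]
  refine ⟨(hX.1.smul s).add (hY.1.smul t), fun v => ?_, fun v => ?_⟩ <;> rw [hq]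
  · have h1 := mul_le_mul_of_nonneg_left (hX.2.1 v) hs
    have h2 := mul_le_mul_of_nonneg_left (hY.2.1 v) ht
    calc a * (v ⬝ᵥ v) = s * (a * (v ⬝ᵥ v)) + t * (a * (v ⬝ᵥ v)) := by rw [← add_mul, hst, one_mul]
      _ ≤ _ := add_le_add h1 h2
  · have h1 := mul_le_mul_of_nonneg_left (hX.2.2 v) hs
    have h2 := mul_le_mul_of_nonneg_left (hY.2.2 v) ht
    calc _ ≤ s * (b * (v ⬝ᵥ v)) + t * (b * (v ⬝ᵥ v)) := add_le_add h1 h2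
      _ = b * (v ⬝ᵥ v) := by rw [← add_mul, hst, one_mul]

lemma frob_sq_le_of_mem {a b : ℝ} (ha : 0 ≤ a) (hab : a ≤ b) {X : Mat n}
    (hX : X ∈ loewnerIcc n a b) : frob X ^ 2 ≤ b ^ 2 * n := by
  have hb : 0 ≤ b := ha.trans hab
  have hX0 : X.PosSemidef := by
    simpa using (loewnerIcc_subset ha le_rfl hX).2.1
  have h1 := ip_nonneg hX0 hX.2.2
  have h2 := ip_nonneg hX.2.2 (Matrix.PosSemidef.one (n := Fin n) (R := ℝ))
  have h3 : ip (1 : Mat n) 1 = n := by simp [ip]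
  rw [ip_sub_right, ip_smul_right] at h1
  rw [ip_sub_left, ip_smul_left, h3] at h2
  rw [frob_sq]
  nlinarith

lemma abs_apply_le_frob (X : Mat n) (i j : Fin n) : |X i j| ≤ frob X := by
  have h := abs_ip_le (Matrix.single i j 1) X
  have h1 : frob (Matrix.single i j 1 : Mat n) = 1 := by
    have := ip_single_left i j (Matrix.single i j 1 : Mat n)
    rw [← frob_sq] at this
    simpa [pow_eq_one_iff_of_nonneg (frob_nonneg _)] using this
  rwa [ip_single_left, h1, one_mul] at h

lemma continuous_ip_right (A : Mat n) : Continuous fun X : Mat n => ip A X := by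
  simp only [ip_eq_sum]; fun_prop

lemma continuous_frob : Continuous (frob : Mat n → ℝ) := by
  unfold frob; fun_prop

/-- A closed set of matrices with uniformly bounded entries is compact. -/
lemma isCompact_of_bounded {s : Set (Mat n)} (hs : IsClosed s) (R : ℝ)
    (h : ∀ X ∈ s, ∀ i j, |X i j| ≤ R) : IsCompact s := by
  have hK : IsCompact (Set.univ.pi fun _ : Fin n => Set.univ.pi fun _ : Fin n => Set.Icc (-R) R) :=
    isCompact_univ_pi fun _ => isCompact_univ_pi fun _ => isCompact_Icc
  exact IsCompact.of_isClosed_subset hK hs fun X hX i _ j _ => abs_le.1 (h X hX i j)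

lemma isCompact_loewnerIcc {a b : ℝ} (ha : 0 ≤ a) (hab : a ≤ b) :
    IsCompact (loewnerIcc n a b) := by
  refine isCompact_of_bounded ?_ (Real.sqrt (b ^ 2 * n)) fun X hX i j =>
    (abs_apply_le_frob X i j).trans (Real.le_sqrt_of_sq_le (frob_sq_le_of_mem ha hab hX))
  have : loewnerIcc n a b = {X | Xᵀ = X} ∩
      ((⋂ v : Fin n → ℝ, {X | a * (v ⬝ᵥ v) ≤ v ⬝ᵥ X *ᵥ v}) ∩
      ⋂ v : Fin n → ℝ, {X | v ⬝ᵥ X *ᵥ v ≤ b * (v ⬝ᵥ v)}) := by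
    ext X
    simp only [mem_loewnerIcc, Set.mem_inter_iff, Set.mem_iInter, Set.mem_ofPred_eq]
    rfl
  rw [this]
  have hc : ∀ v : Fin n → ℝ, Continuous fun X : Mat n => v ⬝ᵥ X *ᵥ v := fun v => by fun_prop
  refine (isClosed_eq (by fun_prop) (by fun_prop)).inter
    ((isClosed_iInter fun v => isClosed_le continuous_const (hc v)).inter
      (isClosed_iInter fun v => isClosed_le (hc v) continuous_const))

lemma continuousOn_log_det {a b : ℝ} (ha : 0 < a) :
    ContinuousOn (fun X : Mat n => Real.log X.det) (loewnerIcc n a b) :=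
  ContinuousOn.log (Continuous.continuousOn (by fun_prop)) fun _ hX =>
    (posDef_of_mem ha hX).det_pos.ne'

variable {S ρ : Mat n} {β : ℝ}

lemma posDef_of_mem_box (ha : 0 < alphaRho S ρ) {X : Mat n} (hX : X ∈ box S ρ β) : X.PosDef :=
  posDef_of_mem ha hX

lemma xopt_isInnerSol (ha : 0 < alphaRho S ρ) (hβ : alphaRho S ρ ≤ β) (U : Mat n) :
    IsInnerSol S ρ β U (Xopt S ρ β U) := by
  refine Classical.epsilon_spec (p := IsInnerSol S ρ β U) ?_
  have hc : ContinuousOn (fun X => phi S ρ X U) (box S ρ β) :=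
    (continuousOn_log_det ha).sub (continuous_ip_right _).continuousOn
  obtain ⟨X, hX, hmax⟩ := (isCompact_loewnerIcc ha.le hβ).exists_isMaxOn
    ⟨_, smul_one_mem_loewnerIcc le_rfl hβ⟩ hc
  exact ⟨X, hX, fun Y hY => hmax hY⟩

lemma isGreatest_of_isInnerSol {U X : Mat n} (hX : IsInnerSol S ρ β U X) :
    IsGreatest ((fun X => phi S ρ X U) '' box S ρ β) (phi S ρ X U) :=
  ⟨⟨X, hX.1, rfl⟩, by rintro _ ⟨Y, hY, rfl⟩; exact hX.2 Y hY⟩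

lemma gBeta_eq_of_isInnerSol {U X : Mat n} (hX : IsInnerSol S ρ β U X) :
    gBeta S ρ β U = phi S ρ X U :=
  (isGreatest_of_isInnerSol hX).csSup_eq

lemma gBeta_eq (ha : 0 < alphaRho S ρ) (hβ : alphaRho S ρ ≤ β) (U : Mat n) :
    gBeta S ρ β U = phi S ρ (Xopt S ρ β U) U :=
  gBeta_eq_of_isInnerSol (xopt_isInnerSol ha hβ U)

lemma phi_le_gBeta (ha : 0 < alphaRho S ρ) (hβ : alphaRho S ρ ≤ β) {X : Mat n}
    (hX : X ∈ box S ρ β) (U : Mat n) : phi S ρ X U ≤ gBeta S ρ β U :=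
  gBeta_eq ha hβ U ▸ (xopt_isInnerSol ha hβ U).2 X hX

lemma phi_sub_phi (X U V : Mat n) : phi S ρ X U - phi S ρ X V = - ip (U - V) (ρ ⊙ X) := by
  simp only [phi, ip_add_left, ip_hadamard_left, ip_sub_left]
  ring

/-! ### The gradient of the dual objective -/

/-- The maximizer `X_β(U)` depends uniformly continuously on `U`. Comparing the maximizers `X` at
`U` and `Y` at `V` with their midpoint shows that the defect of concavity
`2 log det ((X + Y) / 2) - log det X - log det Y` is at most a multiple of `‖U - V‖_F`; by
compactness it is bounded below by a positive constant as long as `X` and `Y` are a fixed distance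
apart. -/
lemma xopt_uniformContinuous (ha : 0 < alphaRho S ρ) (hβ : alphaRho S ρ ≤ β) {η : ℝ}
    (hη : 0 < η) : ∃ δ > 0, ∀ U V : Mat n, frob (U - V) ≤ δ →
      frob (Xopt S ρ β U - Xopt S ρ β V) < η := by
  set R := Real.sqrt (β ^ 2 * n)
  have hR : 0 ≤ R := Real.sqrt_nonneg _
  have hbd : ∀ X ∈ box S ρ β, frob X ≤ R := fun X hX =>
    Real.le_sqrt_of_sq_le (frob_sq_le_of_mem ha.le hβ hX)
  let K : Set (Mat n × Mat n) := (box S ρ β ×ˢ box S ρ β) ∩ {q | η ≤ frob (q.1 - q.2)}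
  let ψ : Mat n × Mat n → ℝ := fun q =>
    2 * Real.log ((1 / 2 : ℝ) • (q.1 + q.2)).det - Real.log q.1.det - Real.log q.2.det
  have hbox : IsCompact (box S ρ β) := isCompact_loewnerIcc ha.le hβ
  have hK : IsCompact K := (hbox.prod hbox).inter_right
    (isClosed_le continuous_const (continuous_frob.comp (by fun_prop)))
  have hpd : ∀ q ∈ K, q.1.PosDef ∧ q.2.PosDef := fun q hq =>
    ⟨posDef_of_mem ha hq.1.1, posDef_of_mem ha hq.1.2⟩
  have hψc : ContinuousOn ψ K := by
    refine ((continuousOn_const.mul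
      (ContinuousOn.log (Continuous.continuousOn (by fun_prop)) ?_)).sub
      (ContinuousOn.log (Continuous.continuousOn (by fun_prop)) ?_)).sub
      (ContinuousOn.log (Continuous.continuousOn (by fun_prop)) ?_)
    · exact fun q hq =>
        (((hpd q hq).1.add (hpd q hq).2).smul (by norm_num : (0 : ℝ) < 1 / 2)).det_pos.ne'
    · exact fun q hq => (hpd q hq).1.det_pos.ne'
    · exact fun q hq => (hpd q hq).2.det_pos.ne'
  have hmin : ∃ c > 0, ∀ q ∈ K, c ≤ ψ q := by
    rcases K.eq_empty_or_nonempty with h | h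
    · exact ⟨1, one_pos, by simp [h]⟩
    · obtain ⟨q, hq, hqm⟩ := hK.exists_isMinOn h hψc
      refine ⟨ψ q, ?_, fun q' hq' => hqm hq'⟩
      have hne : q.1 ≠ q.2 := by
        intro he
        have h2 : η ≤ frob (q.1 - q.2) := hq.2
        rw [he, sub_self] at h2
        have : frob (0 : Mat n) = 0 := by simp [frob]
        linarith
      have := log_det_midpoint_lt (hpd q hq).1 (hpd q hq).2 hne
      simp only [ψ]
      linarith
  obtain ⟨c, hc, hcK⟩ := hmin
  have hC : 0 ≤ frob ρ * R := mul_nonneg (frob_nonneg _) hR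
  refine ⟨c / (frob ρ * R + 1), by positivity, fun U V hUV => ?_⟩
  set X := Xopt S ρ β U with hXdef
  set Y := Xopt S ρ β V with hYdef
  have hX : IsInnerSol S ρ β U X := xopt_isInnerSol ha hβ U
  have hY : IsInnerSol S ρ β V Y := xopt_isInnerSol ha hβ V
  by_contra! hcon
  have h1 : c ≤ ψ (X, Y) := hcK (X, Y) ⟨⟨hX.1, hY.1⟩, hcon⟩
  have hZ : (1 / 2 : ℝ) • (X + Y) ∈ box S ρ β := by
    rw [smul_add]
    exact loewnerIcc_convex hX.1 hY.1 (by norm_num) (by norm_num) (by norm_num)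
  have h2 := hX.2 _ hZ
  have h3 := hY.2 _ hZ
  have h4 := abs_le.1 (abs_ip_le (ρ ⊙ (U - V)) X)
  have h5 := abs_le.1 (abs_ip_le (ρ ⊙ (U - V)) Y)
  have h6 : frob (ρ ⊙ (U - V)) ≤ frob ρ * frob (U - V) := frob_hadamard_le _ _
  have h7 : frob (ρ ⊙ (U - V)) * frob X ≤ frob ρ * frob (U - V) * R :=
    mul_le_mul h6 (hbd X hX.1) (frob_nonneg _) (mul_nonneg (frob_nonneg _) (frob_nonneg _))
  have h8 : frob (ρ ⊙ (U - V)) * frob Y ≤ frob ρ * frob (U - V) * R :=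
    mul_le_mul h6 (hbd Y hY.1) (frob_nonneg _) (mul_nonneg (frob_nonneg _) (frob_nonneg _))
  simp only [phi, ip_smul_right, ip_add_right, ip_add_left, ip_hadamard_left] at h2 h3
  simp only [ip_hadamard_left, ip_sub_left] at h4 h5
  have h9 : ψ (X, Y) ≤ frob ρ * R * frob (U - V) := by
    simp only [ψ]
    linarith
  have h10 : frob ρ * R * frob (U - V) ≤ frob ρ * R * (c / (frob ρ * R + 1)) :=
    mul_le_mul_of_nonneg_left hUV hC
  have h11 : frob ρ * R * (c / (frob ρ * R + 1)) < c := by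
    rw [mul_div_assoc', div_lt_iff₀ (by positivity)]
    nlinarith
  linarith

/-- `-(ρ ∗ X_β(V))` is a subgradient of `g_{ρ,β}` at `V`. -/
lemma gBeta_subgradient (ha : 0 < alphaRho S ρ) (hβ : alphaRho S ρ ≤ β) (U V : Mat n) :
    gBeta S ρ β V - ip (U - V) (ρ ⊙ Xopt S ρ β V) ≤ gBeta S ρ β U := by
  have h1 := phi_le_gBeta ha hβ (xopt_isInnerSol ha hβ V).1 U
  have h2 := phi_sub_phi (S := S) (ρ := ρ) (Xopt S ρ β V) U V
  rw [gBeta_eq ha hβ V]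
  linarith

lemma gBeta_hasLineDerivAt (ha : 0 < alphaRho S ρ) (hβ : alphaRho S ρ ≤ β) (U E : Mat n) :
    HasLineDerivAt ℝ (gBeta S ρ β) (- ip E (ρ ⊙ Xopt S ρ β U)) U E := by
  rw [HasLineDerivAt, hasDerivAt_iff_isLittleO_nhds_zero, Asymptotics.isLittleO_iff]
  intro c hc
  have hB : 0 ≤ frob E * frob ρ := mul_nonneg (frob_nonneg _) (frob_nonneg _)
  obtain ⟨δ, hδ, huc⟩ := xopt_uniformContinuous ha hβ (η := c / (frob E * frob ρ + 1))
    (by positivity)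
  filter_upwards [Metric.ball_mem_nhds (0 : ℝ) (ε := δ / (frob E + 1))
    (div_pos hδ (add_pos_of_nonneg_of_pos (frob_nonneg E) one_pos))] with t ht
  rw [mem_ball_zero_iff, Real.norm_eq_abs, lt_div_iff₀
    (add_pos_of_nonneg_of_pos (frob_nonneg E) one_pos)] at ht
  have hfE : frob (U + t • E - U) ≤ δ := by
    have : frob (U + t • E - U) = |t| * frob E := by
      rw [add_sub_cancel_left, ← abs_of_nonneg (frob_nonneg (t • E)),
        ← abs_of_nonneg (frob_nonneg E),
        ← abs_mul, ← sq_eq_sq_iff_abs_eq_abs, mul_pow, frob_sq, frob_sq, ip_smul_left, ip_smul_right]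
      ring
    rw [this]
    nlinarith [abs_nonneg t]
  have hX := huc _ _ hfE
  set X := Xopt S ρ β U
  set Y := Xopt S ρ β (U + t • E)
  have h1 := gBeta_subgradient ha hβ (U + t • E) U
  have h2 := gBeta_subgradient ha hβ U (U + t • E)
  rw [add_sub_cancel_left, ip_smul_left] at h1
  rw [sub_add_cancel_left, ← neg_smul, ip_smul_left] at h2
  have h3 : ip (t • E) (ρ ⊙ (Y - X)) = t * ip E (ρ ⊙ Y) - t * ip E (ρ ⊙ X) := by
    rw [ip_smul_left, ← mul_sub, ← ip_sub_right]
    congr 2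
    ext i j
    simp [mul_sub]
  have h4 : |ip E (ρ ⊙ (Y - X))| ≤ c := by
    calc _ ≤ frob E * (frob ρ * frob (Y - X)) :=
          (abs_ip_le _ _).trans (mul_le_mul_of_nonneg_left (frob_hadamard_le _ _) (frob_nonneg _))
      _ = frob E * frob ρ * frob (Y - X) := by ring
      _ ≤ frob E * frob ρ * (c / (frob E * frob ρ + 1)) := mul_le_mul_of_nonneg_left hX.le hB
      _ ≤ c := by
        rw [mul_div_assoc', div_le_iff₀ (by positivity)]
        nlinarith
  have h5 : |ip (t • E) (ρ ⊙ (Y - X))| ≤ c * |t| := by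
    rw [ip_smul_left, abs_mul, mul_comm]
    exact mul_le_mul_of_nonneg_right h4 (abs_nonneg t)
  rw [h3] at h5
  have h6 := abs_le.1 h5
  simp only [zero_add, zero_smul, add_zero, smul_eq_mul, Real.norm_eq_abs]
  rw [abs_le]
  have : Y = Xopt S ρ β (U + t • E) := rfl
  constructor <;> linarith

lemma grad_gBeta (ha : 0 < alphaRho S ρ) (hβ : alphaRho S ρ ≤ β) (U : Mat n) :
    grad (gBeta S ρ β) U = -(ρ ⊙ Xopt S ρ β U) := by
  ext i j
  simp only [grad, Matrix.of_apply]
  rw [(gBeta_hasLineDerivAt ha hβ U _).lineDeriv, ip_single_left]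
  simp

lemma gBeta_le_add_ip_grad (ha : 0 < alphaRho S ρ) (hβ : alphaRho S ρ ≤ β) (U V : Mat n) :
    gBeta S ρ β V + ip (U - V) (grad (gBeta S ρ β) V) ≤ gBeta S ρ β U := by
  rw [grad_gBeta ha hβ, ip_neg_right]
  exact gBeta_subgradient ha hβ U V

lemma grad_gBeta_uniformContinuous (ha : 0 < alphaRho S ρ) (hβ : alphaRho S ρ ≤ β) {η : ℝ}
    (hη : 0 < η) : ∃ δ > 0, ∀ U V : Mat n, frob (U - V) ≤ δ →
      frob (grad (gBeta S ρ β) U - grad (gBeta S ρ β) V) ≤ η := by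
  have hρ := frob_nonneg ρ
  obtain ⟨δ, hδ, h⟩ := xopt_uniformContinuous ha hβ (η := η / (frob ρ + 1)) (by positivity)
  refine ⟨δ, hδ, fun U V hUV => ?_⟩
  have h1 := h U V hUV
  have h2 : grad (gBeta S ρ β) U - grad (gBeta S ρ β) V
      = -(ρ ⊙ (Xopt S ρ β U - Xopt S ρ β V)) := by
    rw [grad_gBeta ha hβ, grad_gBeta ha hβ]
    ext i j
    simp
    ring
  rw [h2, frob_neg]
  calc _ ≤ frob ρ * frob (Xopt S ρ β U - Xopt S ρ β V) := frob_hadamard_le _ _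
    _ ≤ frob ρ * (η / (frob ρ + 1)) := mul_le_mul_of_nonneg_left h1.le hρ
    _ ≤ η := by
      rw [mul_div_assoc', div_le_iff₀ (by positivity)]
      nlinarith

lemma frob_grad_gBeta_le (ha : 0 < alphaRho S ρ) (hβ : alphaRho S ρ ≤ β) (U : Mat n) :
    frob (grad (gBeta S ρ β) U) ≤ frob ρ * Real.sqrt (β ^ 2 * n) := by
  rw [grad_gBeta ha hβ, frob_neg]
  exact (frob_hadamard_le _ _).trans (mul_le_mul_of_nonneg_left
    (Real.le_sqrt_of_sq_le (frob_sq_le_of_mem ha.le hβ (xopt_isInnerSol ha hβ U).1)) (frob_nonneg _))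

/-! ### The projection onto the dual feasible set -/

lemma isCompact_setU : IsCompact (setU n) := by
  refine isCompact_of_bounded ?_ 1 fun U hU => hU.2
  have : setU n = {U | Uᵀ = U} ∩ ⋂ i : Fin n, ⋂ j : Fin n, {U | |U i j| ≤ 1} := by
    ext U
    simp only [Set.mem_inter_iff, Set.mem_iInter]
    rfl
  rw [this]
  exact (isClosed_eq (by fun_prop) (by fun_prop)).inter (isClosed_iInter fun i =>
    isClosed_iInter fun j => isClosed_le (by fun_prop) continuous_const)

lemma setU_segment {U V : Mat n} (hU : U ∈ setU n) (hV : V ∈ setU n) {t : ℝ} (h0 : 0 ≤ t)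
    (h1 : t ≤ 1) : U + t • (V - U) ∈ setU n := by
  refine ⟨hU.1.add ((hV.1.sub hU.1).smul t), fun i j => ?_⟩
  have hu := abs_le.1 (hU.2 i j)
  have hv := abs_le.1 (hV.2 i j)
  simp only [Matrix.add_apply, Matrix.smul_apply, Matrix.sub_apply, smul_eq_mul]
  rw [abs_le]
  constructor <;> nlinarith

lemma frob_sub_le_of_mem_setU {U V : Mat n} (hU : U ∈ setU n) (hV : V ∈ setU n) :
    frob (U - V) ≤ 2 * n := by
  apply abs_le_of_sq_le_sq' _ (by positivity) |>.2
  rw [frob_sq, ip_eq_sum]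
  calc _ ≤ ∑ _i : Fin n, ∑ _j : Fin n, (4 : ℝ) := by
        refine Finset.sum_le_sum fun i _ => Finset.sum_le_sum fun j _ => ?_
        have hu := abs_le.1 (hU.2 i j)
        have hv := abs_le.1 (hV.2 i j)
        simp only [Matrix.sub_apply]
        nlinarith
    _ = (2 * n) ^ 2 := by simp; ring

lemma projU_spec (A : Mat n) :
    projU A ∈ setU n ∧ ∀ W ∈ setU n, frob (projU A - A) ≤ frob (W - A) := by
  refine Classical.epsilon_spec
    (p := fun V => V ∈ setU n ∧ ∀ W ∈ setU n, frob (V - A) ≤ frob (W - A)) ?_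
  obtain ⟨V, hV, hmin⟩ := isCompact_setU.exists_isMinOn
    (⟨0, by simp [setU, Matrix.IsSymm]⟩ : (setU n).Nonempty)
    (continuous_frob.comp (continuous_id.sub continuous_const) :
      Continuous fun V : Mat n => frob (V - A)).continuousOn
  exact ⟨V, hV, fun W hW => hmin hW⟩

/-- The variational inequality of the projection onto the convex set `setU n`. -/
lemma projU_variational (A : Mat n) {W : Mat n} (hW : W ∈ setU n) :
    0 ≤ ip (projU A - A) (W - projU A) := by
  obtain ⟨hV, hmin⟩ := projU_spec A
  set V := projU A
  by_contra! hneg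
  set c := ip (V - A) (W - V)
  set q := ip (W - V) (W - V)
  have hq : 0 ≤ q := ip_self_nonneg _
  have key : ∀ t : ℝ, 0 < t → t ≤ 1 → 0 ≤ 2 * c + t * q := by
    intro t h0 h1
    have h2 := pow_le_pow_left₀ (frob_nonneg _) (hmin _ (setU_segment hV hW h0.le h1)) 2
    rw [frob_sq, frob_sq, add_sub_right_comm] at h2
    simp only [ip_add_left _ (t • _), ip_add_right _ _ (t • _), ip_smul_left, ip_smul_right] at h2
    rw [ip_comm (W - V) (V - A)] at h2
    have h3 : 0 ≤ t * (2 * c + t * q) := by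
      simp only [c, q]
      linarith
    exact nonneg_of_mul_nonneg_right h3 h0
  have ht : 0 < min 1 (-c / (q + 1)) := lt_min one_pos (div_pos (by linarith) (by linarith))
  have h1 := key _ ht (min_le_left _ _)
  have h2 : min 1 (-c / (q + 1)) * q ≤ -c / (q + 1) * q :=
    mul_le_mul_of_nonneg_right (min_le_right _ _) hq
  have h3 : -c / (q + 1) * q ≤ -c := by
    rw [div_mul_eq_mul_div, div_le_iff₀ (by linarith)]
    nlinarith
  linarith

/-! ### The duality gap -/

/-- The matrix of signs of `X`, which minimizes `U ↦ φ(X, U)` over `setU n`. -/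
noncomputable def signMat (X : Mat n) : Mat n := Matrix.of fun i j => if 0 ≤ X i j then 1 else -1

lemma signMat_mem {X : Mat n} (hX : X.IsSymm) : signMat X ∈ setU n := by
  refine ⟨?_, fun i j => ?_⟩
  · ext i j
    simp [signMat, hX.apply i j]
  · simp only [signMat, Matrix.of_apply]
    split_ifs <;> simp

lemma phi_eq (S ρ X U : Mat n) :
    phi S ρ X U = Real.log X.det - ip S X - ∑ i, ∑ j, ρ i j * (U i j * X i j) := by
  simp only [phi, ip_add_left, ip_eq_sum (ρ ⊙ U), Matrix.hadamard_apply, mul_assoc]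
  ring

lemma phi_signMat (S ρ X : Mat n) : phi S ρ X (signMat X) = penaltyVal S ρ X := by
  rw [phi_eq, penaltyVal]
  congr 1
  refine Finset.sum_congr rfl fun i _ => Finset.sum_congr rfl fun j _ => ?_
  simp only [signMat, Matrix.of_apply]
  split_ifs with h
  · rw [abs_of_nonneg h, one_mul]
  · rw [abs_of_neg (not_le.1 h), neg_one_mul]

lemma penaltyVal_le_phi (hρ : ∀ i j, 0 ≤ ρ i j) (X : Mat n) {U : Mat n}
    (hU : U ∈ setU n) : penaltyVal S ρ X ≤ phi S ρ X U := by
  rw [phi_eq, penaltyVal]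
  refine sub_le_sub_left (Finset.sum_le_sum fun i _ => Finset.sum_le_sum fun j _ =>
    mul_le_mul_of_nonneg_left ?_ (hρ i j)) _
  calc U i j * X i j ≤ |U i j| * |X i j| := by rw [← abs_mul]; exact le_abs_self _
    _ ≤ _ := mul_le_of_le_one_left (abs_nonneg _) (hU.2 i j)

lemma fRho_eq (hρ : ∀ i j, 0 ≤ ρ i j) {X : Mat n} (hX : X.IsSymm) :
    fRho S ρ X = penaltyVal S ρ X := by
  refine IsLeast.csInf_eq ⟨⟨signMat X, signMat_mem hX, phi_signMat S ρ X⟩, ?_⟩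
  rintro _ ⟨U, hU, rfl⟩
  exact penaltyVal_le_phi hρ X hU

/-- The duality gap at `U` is a first-order quantity: it is attained as `⟨U - W, ∇g(U)⟩`. -/
lemma exists_gap_eq (hρ : ∀ i j, 0 ≤ ρ i j) (ha : 0 < alphaRho S ρ) (hβ : alphaRho S ρ ≤ β)
    (U : Mat n) : ∃ W ∈ setU n, gBeta S ρ β U - fRho S ρ (Xopt S ρ β U)
      = ip (U - W) (grad (gBeta S ρ β) U) := by
  have hX := (xopt_isInnerSol ha hβ U).1.1
  refine ⟨_, signMat_mem hX, ?_⟩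
  rw [fRho_eq hρ hX, ← phi_signMat, gBeta_eq ha hβ, phi_sub_phi, grad_gBeta ha hβ, ip_neg_right]

/-! ### The spectral projected gradient step -/

lemma direction_ip_grad_le (g : Mat n → ℝ) {U : Mat n} (hU : U ∈ setU n) {α αmax : ℝ}
    (h0 : 0 < α) (h1 : α ≤ αmax) :
    ip (direction g U α) (grad g U) ≤ - (frob (direction g U α) ^ 2 / αmax) := by
  have h := projU_variational (U - α • grad g U) hU
  set d := direction g U α with hd
  have e1 : projU (U - α • grad g U) - (U - α • grad g U) = d + α • grad g U := by
    rw [hd, direction]; abel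
  have e2 : U - projU (U - α • grad g U) = -d := by rw [hd, direction]; abel
  rw [e1, e2, ip_neg_right, ip_add_left, ip_smul_left, ← frob_sq, ip_comm _ d] at h
  have h2 : ip d (grad g U) ≤ - (frob d ^ 2 / α) := by
    rw [← neg_div, le_div_iff₀ h0]
    linarith
  have h3 : frob d ^ 2 / αmax ≤ frob d ^ 2 / α := div_le_div_of_nonneg_left (sq_nonneg _) h0 h1
  linarith

/-- A short search direction forces a small value of every first-order decrease
`⟨U - W, ∇g(U)⟩`. -/
lemma ip_grad_le_direction (g : Mat n → ℝ) {U W : Mat n} (hU : U ∈ setU n) (hW : W ∈ setU n)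
    {α αmin G : ℝ} (hmin : 0 < αmin) (h0 : αmin ≤ α) (hG : frob (grad g U) ≤ G) :
    ip (U - W) (grad g U) ≤ (G + 2 * n / αmin) * frob (direction g U α) := by
  have hα : 0 < α := hmin.trans_le h0
  have h := projU_variational (U - α • grad g U) hW
  set d := direction g U α with hd
  have e1 : projU (U - α • grad g U) - (U - α • grad g U) = d + α • grad g U := by
    rw [hd, direction]; abel
  have e2 : W - projU (U - α • grad g U) = (W - U) - d := by rw [hd, direction]; abel
  rw [e1, e2, ip_sub_right, ip_add_left, ip_add_left, ip_smul_left, ip_smul_left, ← frob_sq] at h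
  have e3 : ip (U - W) (grad g U) = - ip (grad g U) (W - U) := by
    rw [ip_comm, ip_sub_right, ip_sub_right]; ring
  have hdn := frob_nonneg d
  have h1 : - ip (grad g U) d ≤ G * frob d := by
    have := (abs_le.1 (abs_ip_le (grad g U) d)).1
    nlinarith
  have h2 : ip d (W - U) ≤ 2 * n * frob d := by
    have := (abs_le.1 (abs_ip_le d (W - U))).2
    have := frob_sub_le_of_mem_setU hW hU
    nlinarith
  have h3 : α * ip (U - W) (grad g U) ≤ α * (G * frob d) + 2 * n * frob d := by
    rw [e3]
    have := mul_le_mul_of_nonneg_left h1 hα.le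
    nlinarith [sq_nonneg (frob d)]
  have h4 : ip (U - W) (grad g U) ≤ G * frob d + 2 * n * frob d / α := by
    have : α * (G * frob d + 2 * n * frob d / α) = α * (G * frob d) + 2 * n * frob d := by
      field_simp
    rw [← this] at h3
    exact le_of_mul_le_mul_left h3 hα
  have h5 : 2 * n * frob d / α ≤ 2 * n * frob d / αmin :=
    div_le_div_of_nonneg_left (by positivity) hmin h0
  calc _ ≤ G * frob d + 2 * n * frob d / αmin := by linarith
    _ = _ := by ring

lemma add_smul_direction_mem (g : Mat n → ℝ) {U : Mat n} (hU : U ∈ setU n) (α : ℝ) {lam : ℝ}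
    (h0 : 0 ≤ lam) (h1 : lam ≤ 1) : U + lam • direction g U α ∈ setU n :=
  setU_segment hU (projU_spec _).1 h0 h1

lemma frob_direction_le (g : Mat n → ℝ) {U : Mat n} (hU : U ∈ setU n) (α : ℝ) :
    frob (direction g U α) ≤ 2 * n :=
  frob_sub_le_of_mem_setU (projU_spec _).1 hU

/-- As long as the duality gap exceeds `ε`, the search directions are bounded away from `0`. -/
lemma exists_le_frob_direction (hρ : ∀ i j, 0 ≤ ρ i j) (ha : 0 < alphaRho S ρ)
    (hβ : alphaRho S ρ ≤ β) {ε : ℝ} (hε : 0 < ε) (p : SPGParams) :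
    ∃ δ > 0, ∀ U ∈ setU n, ∀ α, p.αmin ≤ α →
      ε < gBeta S ρ β U - fRho S ρ (Xopt S ρ β U) → δ ≤ frob (direction (gBeta S ρ β) U α) := by
  set G := frob ρ * Real.sqrt (β ^ 2 * n)
  have hG : 0 ≤ G := mul_nonneg (frob_nonneg _) (Real.sqrt_nonneg _)
  have hc : 0 < G + 2 * n / p.αmin + 1 := by
    have := p.αmin_pos
    positivity
  refine ⟨ε / (G + 2 * n / p.αmin + 1), div_pos hε hc, fun U hU α hα hgap => ?_⟩
  obtain ⟨W, hW, hWe⟩ := exists_gap_eq hρ ha hβ U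
  have h := ip_grad_le_direction (gBeta S ρ β) hU hW p.αmin_pos hα (frob_grad_gBeta_le ha hβ U)
  rw [div_le_iff₀ hc]
  have := frob_nonneg (direction (gBeta S ρ β) U α)
  rw [← hWe] at h
  linarith

lemma le_gMax (g : Mat n → ℝ) (M k : ℕ) (U : ℕ → Mat n) : g (U k) ≤ gMax g M k U :=
  Finset.le_sup' (fun j => g (U (k - j))) (Finset.mem_range.2 (Nat.succ_pos _) : 0 ∈ _)

/-- As long as the duality gap exceeds `ε`, every sufficiently short trial step is accepted, with
a threshold that does not depend on the iterate. By convexity, the increment of `g` along `λ d` is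
at most `λ ⟨d, ∇g(U + λ d)⟩`, and the uniform continuity of `∇g` lets `∇g(U)` replace the
gradient. -/
lemma exists_accepts (hρ : ∀ i j, 0 ≤ ρ i j) (ha : 0 < alphaRho S ρ) (hβ : alphaRho S ρ ≤ β)
    {ε : ℝ} (hε : 0 < ε) (p : SPGParams) :
    ∃ lam₀ > 0, ∀ (k : ℕ) (U : ℕ → Mat n) (α lam : ℝ), U k ∈ setU n → p.αmin ≤ α → α ≤ p.αmax →
      ε < gBeta S ρ β (U k) - fRho S ρ (Xopt S ρ β (U k)) → 0 < lam → lam ≤ lam₀ →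
      Accepts p (gBeta S ρ β) k U α lam := by
  obtain ⟨δ, hδ, hdir⟩ := exists_le_frob_direction hρ ha hβ hε p
  have hmax : 0 < p.αmax := p.αmin_pos.trans p.αmin_lt
  have hγ : 0 < 1 - p.γ := sub_pos.2 p.γ_lt
  obtain ⟨r, hr, hgr⟩ := grad_gBeta_uniformContinuous ha hβ
    (η := (1 - p.γ) * δ / p.αmax) (by positivity)
  have hn : (0 : ℝ) < 2 * n + 1 := by positivity
  refine ⟨r / (2 * n + 1), by positivity, fun k U α lam hU h1 h2 hgap hl0 hl => ?_⟩
  set g := gBeta S ρ β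
  have hd1 := hdir (U k) hU α h1 hgap
  have hd2 := frob_direction_le g hU α
  have hd3 := direction_ip_grad_le g hU (p.αmin_pos.trans_le h1) h2
  set d := direction g (U k) α
  set V := U k + lam • d with hV
  have hVU : frob (V - U k) ≤ r := by
    have h3 : frob (V - U k) ^ 2 = (lam * frob d) ^ 2 := by
      rw [hV, add_sub_cancel_left, mul_pow, frob_sq, frob_sq, ip_smul_left, ip_smul_right]
      ring
    rw [(pow_left_inj₀ (frob_nonneg _) (mul_nonneg hl0.le (frob_nonneg _)) two_ne_zero).1 h3]
    rw [le_div_iff₀ hn] at hl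
    nlinarith
  have h4 := hgr V (U k) hVU
  have h5 := gBeta_le_add_ip_grad ha hβ (U k) V
  have e1 : U k - V = (-lam) • d := by rw [hV, neg_smul]; abel
  rw [e1, ip_smul_left] at h5
  have h6 : ip d (grad g V) - ip d (grad g (U k)) ≤ (1 - p.γ) * (frob d ^ 2 / p.αmax) := by
    rw [← ip_sub_right]
    calc _ ≤ frob d * frob (grad g V - grad g (U k)) := (abs_le.1 (abs_ip_le _ _)).2
      _ ≤ frob d * ((1 - p.γ) * δ / p.αmax) := mul_le_mul_of_nonneg_left h4 (frob_nonneg _)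
      _ ≤ frob d * ((1 - p.γ) * frob d / p.αmax) := by gcongr; exact frob_nonneg d
      _ = _ := by ring
  have h7 : ip d (grad g V) ≤ p.γ * ip d (grad g (U k)) := by
    nlinarith
  have h8 := mul_le_mul_of_nonneg_left h7 hl0.le
  have h9 := le_gMax g p.M k U
  change g V ≤ _
  change g V + _ ≤ g (U k) at h5
  linarith

lemma nextAlpha_mem (p : SPGParams) (g : Mat n → ℝ) (U V : Mat n) :
    nextAlpha p g U V ∈ Set.Icc p.αmin p.αmax := by
  have := p.αmin_lt.le
  simp only [nextAlpha]
  split_ifs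
  · exact ⟨this, le_rfl⟩
  · exact ⟨le_min this (le_max_left _ _), min_le_left _ _⟩

/-! ### Termination of the method -/

variable {ε r : ℝ} {p : SPGParams}

/-- An accepted step at an iterate with duality gap larger than `ε` decreases the nonmonotone
reference value by at least a fixed multiple of the trial length. -/
lemma exists_decrease (hρ : ∀ i j, 0 ≤ ρ i j) (ha : 0 < alphaRho S ρ) (hβ : alphaRho S ρ ≤ β)
    (hε : 0 < ε) (p : SPGParams) {lam₁ : ℝ} (hlam₁ : 0 < lam₁) :
    ∃ η > 0, ∀ (k : ℕ) (U : ℕ → Mat n) (α lam : ℝ), U k ∈ setU n → p.αmin ≤ α → α ≤ p.αmax →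
      ε < gBeta S ρ β (U k) - fRho S ρ (Xopt S ρ β (U k)) → lam₁ ≤ lam →
      Accepts p (gBeta S ρ β) k U α lam →
      gBeta S ρ β (U k + lam • direction (gBeta S ρ β) (U k) α)
        ≤ gMax (gBeta S ρ β) p.M k U - η := by
  obtain ⟨δ, hδ, hdir⟩ := exists_le_frob_direction hρ ha hβ hε p
  have hmax : 0 < p.αmax := p.αmin_pos.trans p.αmin_lt
  have hγ := p.γ_pos
  refine ⟨p.γ * lam₁ * (δ ^ 2 / p.αmax), by positivity,
    fun k U α lam hU h1 h2 hgap hl hacc => hacc.trans ?_⟩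
  have hd1 := hdir (U k) hU α h1 hgap
  have hd3 := direction_ip_grad_le (gBeta S ρ β) hU (p.αmin_pos.trans_le h1) h2
  have h3 : δ ^ 2 / p.αmax ≤ frob (direction (gBeta S ρ β) (U k) α) ^ 2 / p.αmax := by gcongr
  have h4 : p.γ * lam₁ * (δ ^ 2 / p.αmax)
      ≤ p.γ * lam * (frob (direction (gBeta S ρ β) (U k) α) ^ 2 / p.αmax) := by
    have : 0 ≤ p.γ * lam := mul_nonneg hγ.le (hlam₁.le.trans hl)
    gcongr
  have h5 := mul_le_mul_of_nonneg_left hd3 (mul_nonneg hγ.le (hlam₁.le.trans hl))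
  linarith

lemma exists_le_gBeta (ha : 0 < alphaRho S ρ) (hβ : alphaRho S ρ ≤ β) :
    ∃ B, ∀ U ∈ setU n, B ≤ gBeta S ρ β U := by
  refine ⟨gBeta S ρ β 0 - 2 * n * frob (grad (gBeta S ρ β) 0), fun U hU => ?_⟩
  have h := gBeta_le_add_ip_grad ha hβ U 0
  have h0 : (0 : Mat n) ∈ setU n := by simp [setU, Matrix.IsSymm]
  have h1 := (abs_le.1 (abs_ip_le (U - 0) (grad (gBeta S ρ β) 0))).1
  have h2 := mul_le_mul_of_nonneg_right (frob_sub_le_of_mem_setU hU h0)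
    (frob_nonneg (grad (gBeta S ρ β) 0))
  linarith

/-- If `g(U_j) ≤ c - η j / M` for all `j ≤ k`, then `g^M_k - η ≤ c - η (k + 1) / M`: the `M` most
recent indices differ from `k + 1` by at most `M`. -/
lemma gMax_sub_le {g : Mat n → ℝ} {M k : ℕ} (hM : 1 ≤ M) {U : ℕ → Mat n} {c η : ℝ} (hη : 0 < η)
    (h : ∀ j ≤ k, g (U j) ≤ c - η * j / M) : gMax g M k U - η ≤ c - η * (k + 1 : ℕ) / M := by
  rw [sub_le_iff_le_add]
  refine Finset.sup'_le _ _ fun j hj => (h (k - j) (Nat.sub_le k j)).trans ?_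
  have hj' : j ≤ k ∧ j + 1 ≤ M := by
    rw [Finset.mem_range] at hj; omega
  have hM' : (0 : ℝ) < M := by exact_mod_cast hM
  have hjM : (j : ℝ) + 1 ≤ M := by exact_mod_cast hj'.2
  have e : c - η * (k + 1 : ℕ) / M + η - (c - η * (k - j : ℕ) / M) = η * (M - (j + 1)) / M := by
    push_cast [hj'.1]
    field_simp
    ring
  have : 0 ≤ η * (M - (j + 1)) / M := by
    have := sub_nonneg.2 hjM
    positivity
  linarith

/-- Every SPG run returns after finitely many steps. If the gap exceeded `ε` up to iterate `k`,
then `g(U_k) ≤ g(U_0) - η k / M` with a fixed `η > 0`, which bounds `k` since `g` is bounded below;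
within an iteration the trial lengths shrink by the factor `σ₂` until they reach the uniform
acceptance threshold `lam₀`. -/
lemma acc_test (hρ : ∀ i j, 0 ≤ ρ i j) (ha : 0 < alphaRho S ρ) (hβ : alphaRho S ρ ≤ β)
    (hε : 0 < ε) {m : ℕ}
    (hret : ∀ Uhat ∈ setU n, Acc (fun t s => Step S ρ ε p r s t) (.returned m β Uhat))
    {U₀ : Mat n} (hU₀ : U₀ ∈ setU n) {α₀ : ℝ} (hα₀ : α₀ ∈ Set.Icc p.αmin p.αmax) :
    Acc (fun t s => Step S ρ ε p r s t) (.test m β 0 (fun _ => U₀) α₀) := by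
  obtain ⟨lam₀, hlam₀, hshort⟩ := exists_accepts hρ ha hβ hε p
  have hσ₁ := p.σ₁_pos
  have hσ₂ : 0 < p.σ₂ := p.σ₁_pos.trans p.σ₁_lt
  obtain ⟨η, hη, hdec⟩ := exists_decrease hρ ha hβ hε p
    (lam₁ := min 1 (p.σ₁ * lam₀)) (lt_min one_pos (by positivity))
  obtain ⟨B, hB⟩ := exists_le_gBeta ha hβ
  set g := gBeta S ρ β with hg
  have hM : (0 : ℝ) < p.M := by exact_mod_cast p.one_le_M
  obtain ⟨K, hK⟩ := exists_nat_gt ((g U₀ - B) * p.M / η)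
  rw [div_lt_iff₀ hη] at hK
  suffices H : ∀ N k (U : ℕ → Mat n) (α : ℝ), K ≤ k + N → α ∈ Set.Icc p.αmin p.αmax →
      (∀ j ≤ k, U j ∈ setU n ∧ g (U j) ≤ g U₀ - η * j / p.M) →
      Acc (fun t s => Step S ρ ε p r s t) (.test m β k U α) by
    refine H K 0 _ _ (by omega) hα₀ fun j hj => ?_
    obtain rfl : j = 0 := by omega
    exact ⟨hU₀, by simp⟩
  intro N
  induction N with
  | zero =>
    intro k U α hk _ hU
    exfalso
    have h1 := (hU k le_rfl).2
    have h2 := hB _ (hU k le_rfl).1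
    have h3 : (K : ℝ) ≤ k := by exact_mod_cast hk
    have h4 : η * k / p.M ≤ g U₀ - B := by linarith
    rw [div_le_iff₀ hM] at h4
    nlinarith
  | succ N ih =>
    intro k U α hk hα hU
    refine Acc.intro _ fun t ht => ?_
    cases ht with
    | testPass => exact hret _ (hU k le_rfl).1
    | testFail _ _ _ _ _ hgap =>
      rw [not_le] at hgap
      have accept : ∀ lam, 0 < lam → lam ≤ 1 → min 1 (p.σ₁ * lam₀) ≤ lam → Accepts p g k U α lam →
          Acc (fun t s => Step S ρ ε p r s t) (.test m β (k + 1)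
            (Function.update U (k + 1) (U k + lam • direction g (U k) α))
            (nextAlpha p g (U k) (U k + lam • direction g (U k) α))) := by
        intro lam h0 h1 hl hacc
        refine ih _ _ _ (by omega) (nextAlpha_mem _ _ _ _) fun j hj => ?_
        rcases Nat.lt_or_eq_of_le hj with hj | rfl
        · rw [Function.update_of_ne hj.ne]
          exact hU j (by omega)
        · rw [Function.update_self]
          refine ⟨add_smul_direction_mem g (hU k le_rfl).1 α h0.le h1, ?_⟩
          exact (hdec k U α lam (hU k le_rfl).1 hα.1 hα.2 hgap hl hacc).trans
            (gMax_sub_le p.one_le_M hη fun j hj => (hU j hj).2)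
      have search : ∀ i lam, 0 < lam → lam ≤ 1 → min 1 (p.σ₁ * lam₀) ≤ lam →
          p.σ₂ ^ i * lam ≤ lam₀ →
          Acc (fun t s => Step S ρ ε p r s t) (.search m β k U α lam) := by
        intro i
        induction i with
        | zero =>
          intro lam h0 h1 hl hi
          refine Acc.intro _ fun t ht => ?_
          cases ht with
          | accept _ _ _ _ _ _ V hacc hV => subst hV; exact accept lam h0 h1 hl hacc
          | backtrack _ _ _ _ _ _ lam' hrej _ =>
            exact absurd (hshort k U α lam (hU k le_rfl).1 hα.1 hα.2 hgap h0 (by simpa using hi))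
              hrej
        | succ i ihi =>
          intro lam h0 h1 hl hi
          refine Acc.intro _ fun t ht => ?_
          cases ht with
          | accept _ _ _ _ _ _ V hacc hV => subst hV; exact accept lam h0 h1 hl hacc
          | backtrack _ _ _ _ _ _ lam' hrej hlam' =>
            have hlt : lam₀ < lam := by
              by_contra! hle
              exact hrej (hshort k U α lam (hU k le_rfl).1 hα.1 hα.2 hgap h0 hle)
            have h2 : p.σ₁ * lam₀ ≤ p.σ₁ * lam := by gcongr
            refine ihi lam' ((mul_pos hσ₁ h0).trans_le hlam'.1) ?_ ?_ ?_
            · have := p.σ₂_lt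
              nlinarith [hlam'.2]
            · exact (min_le_right _ _).trans (h2.trans hlam'.1)
            · calc p.σ₂ ^ i * lam' ≤ p.σ₂ ^ i * (p.σ₂ * lam) := by
                    gcongr
                    exact hlam'.2
                _ = p.σ₂ ^ (i + 1) * lam := by ring
                _ ≤ lam₀ := hi
      obtain ⟨i, hi⟩ := exists_pow_lt_of_lt_one hlam₀ p.σ₂_lt
      exact search i 1 one_pos le_rfl (min_le_left _ _) (by simpa using hi.le)

/-- The bound after `m` raises. -/
noncomputable def boundSeq (S ρ : Mat n) (β₀ r : ℝ) (m : ℕ) : ℝ := min (β₀ * r ^ m) (betaRho S ρ)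

lemma boundSeq_succ {β₀ : ℝ} {m : ℕ} (h : boundSeq S ρ β₀ r m ≠ betaRho S ρ) :
    min (boundSeq S ρ β₀ r m * r) (betaRho S ρ) = boundSeq S ρ β₀ r (m + 1) := by
  have : boundSeq S ρ β₀ r m = β₀ * r ^ m := by
    rcases min_choice (β₀ * r ^ m) (betaRho S ρ) with h1 | h1
    · exact h1
    · exact absurd h1 h
  rw [this, boundSeq, pow_succ, mul_assoc]

lemma alphaRho_le_boundSeq {β₀ : ℝ} (ha : 0 < alphaRho S ρ) (hβ₀ : alphaRho S ρ ≤ β₀)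
    (hβ₀' : β₀ ≤ betaRho S ρ) (hr : 1 < r) (m : ℕ) : alphaRho S ρ ≤ boundSeq S ρ β₀ r m := by
  refine le_min (hβ₀.trans ?_) (hβ₀.trans hβ₀')
  exact le_mul_of_one_le_right (ha.trans_le hβ₀).le (one_le_pow₀ hr.le)

lemma boundSeq_eq_of_le {β₀ : ℝ} (hβ₀ : 0 ≤ β₀) (hr : 1 < r) {N m : ℕ}
    (hN : betaRho S ρ ≤ β₀ * r ^ N) (hm : N ≤ m) : boundSeq S ρ β₀ r m = betaRho S ρ :=
  min_eq_right (hN.trans (mul_le_mul_of_nonneg_left (pow_le_pow_right₀ hr.le hm) hβ₀))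

/-- The invariant of the executions: the bound is the one belonging to the number of raises, which
is at most `N`, all iterates that are still needed are feasible, and a returned point has a duality
gap of at most `ε`. -/
def Inv (S ρ : Mat n) (ε : ℝ) (p : SPGParams) (r β₀ : ℝ) (N : ℕ) : State n → Prop
  | .test m β k U α =>
      β = boundSeq S ρ β₀ r m ∧ m ≤ N ∧ U k ∈ setU n ∧ α ∈ Set.Icc p.αmin p.αmax
  | .search m β k U α lam =>
      β = boundSeq S ρ β₀ r m ∧ m ≤ N ∧ U k ∈ setU n ∧ α ∈ Set.Icc p.αmin p.αmax ∧
        0 < lam ∧ lam ≤ 1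
  | .returned m β Uhat =>
      β = boundSeq S ρ β₀ r m ∧ m ≤ N ∧ Uhat ∈ setU n ∧
        gBeta S ρ β Uhat - fRho S ρ (Xopt S ρ β Uhat) ≤ ε
  | .done m β Uhat =>
      β = boundSeq S ρ β₀ r m ∧ m ≤ N ∧ Uhat ∈ setU n ∧
        gBeta S ρ β Uhat - fRho S ρ (Xopt S ρ β Uhat) ≤ ε ∧
        (β = betaRho S ρ ∨ lamMax (Xopt S ρ β Uhat) < β)

lemma Inv.step {β₀ : ℝ} {N : ℕ} (hβ₀ : 0 ≤ β₀) (hr : 1 < r) (hN : betaRho S ρ ≤ β₀ * r ^ N)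
    {s t : State n} (hs : Inv S ρ ε p r β₀ N s) (hst : Step S ρ ε p r s t) :
    Inv S ρ ε p r β₀ N t := by
  cases hst with
  | testPass m β k U α h => exact ⟨hs.1, hs.2.1, hs.2.2.1, h⟩
  | testFail m β k U α h => exact ⟨hs.1, hs.2.1, hs.2.2.1, hs.2.2.2, one_pos, le_rfl⟩
  | accept m β k U α lam V h hV =>
    obtain ⟨h1, h2, h3, h4, h5, h6⟩ := hs
    refine ⟨h1, h2, ?_, nextAlpha_mem _ _ _ _⟩
    rw [Function.update_self, hV]
    exact add_smul_direction_mem _ h3 α h5.le h6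
  | backtrack m β k U α lam lam' h hlam =>
    obtain ⟨h1, h2, h3, h4, h5, h6⟩ := hs
    refine ⟨h1, h2, h3, h4, (mul_pos p.σ₁_pos h5).trans_le hlam.1, ?_⟩
    have := p.σ₂_lt
    nlinarith [hlam.2]
  | finish m β Uhat h => exact ⟨hs.1, hs.2.1, hs.2.2.1, hs.2.2.2, h⟩
  | raise m β Uhat α h hα =>
    obtain ⟨rfl, h2, h3, -⟩ := hs
    have hne := (not_or.1 h).1
    refine ⟨boundSeq_succ hne, ?_, h3, hα⟩
    by_contra! hlt
    exact hne (boundSeq_eq_of_le hβ₀ hr hN (by omega))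

lemma Inv.reachable {β₀ : ℝ} {N : ℕ} (hβ₀ : 0 ≤ β₀) (hr : 1 < r) (hN : betaRho S ρ ≤ β₀ * r ^ N)
    (hβ₀' : β₀ ≤ betaRho S ρ) {U₀ : Mat n} (hU₀ : U₀ ∈ setU n) {α₀ : ℝ}
    (hα₀ : α₀ ∈ Set.Icc p.αmin p.αmax) {s : State n}
    (hs : Reachable S ρ ε p r β₀ U₀ α₀ s) : Inv S ρ ε p r β₀ N s := by
  induction hs with
  | refl => exact ⟨by simp [boundSeq, hβ₀'], Nat.zero_le N, hU₀, hα₀⟩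
  | tail _ hst ih => exact ih.step hβ₀ hr hN hst

lemma Inv.progress {β₀ : ℝ} {N : ℕ} {s : State n} (hs : Inv S ρ ε p r β₀ N s) :
    (∃ m β Uhat, s = .done m β Uhat) ∨ ∃ t, Step S ρ ε p r s t := by
  cases s with
  | test m β k U α =>
    right
    by_cases h : gBeta S ρ β (U k) - fRho S ρ (Xopt S ρ β (U k)) ≤ ε
    · exact ⟨_, .testPass m β k U α h⟩
    · exact ⟨_, .testFail m β k U α h⟩
  | search m β k U α lam =>
    right
    obtain ⟨-, -, -, -, h5, -⟩ := hs
    by_cases h : Accepts p (gBeta S ρ β) k U α lam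
    · exact ⟨_, .accept m β k U α lam _ h rfl⟩
    · exact ⟨_, .backtrack m β k U α lam _ h
        ⟨le_rfl, mul_le_mul_of_nonneg_right p.σ₁_lt.le h5.le⟩⟩
  | returned m β Uhat =>
    right
    by_cases h : β = betaRho S ρ ∨ lamMax (Xopt S ρ β Uhat) < β
    · exact ⟨_, .finish m β Uhat h⟩
    · exact ⟨_, .raise m β Uhat p.αmin h ⟨le_rfl, p.αmin_lt.le⟩⟩
  | done m β Uhat => exact Or.inl ⟨m, β, Uhat, rfl⟩

lemma Inv.raises_le {β₀ : ℝ} {N : ℕ} {s : State n} (hs : Inv S ρ ε p r β₀ N s) :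
    s.raises ≤ N := by
  cases s <;> exact hs.2.1

lemma acc_initState (hρ : ∀ i j, 0 ≤ ρ i j) (ha : 0 < alphaRho S ρ) (hε : 0 < ε) (hr : 1 < r)
    {β₀ : ℝ} (hβ₀ : alphaRho S ρ ≤ β₀) (hβ₀' : β₀ ≤ betaRho S ρ) {N : ℕ}
    (hN : betaRho S ρ ≤ β₀ * r ^ N) {U₀ : Mat n} (hU₀ : U₀ ∈ setU n) {α₀ : ℝ}
    (hα₀ : α₀ ∈ Set.Icc p.αmin p.αmax) :
    Acc (fun t s => Step S ρ ε p r s t) (initState β₀ U₀ α₀) := by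
  have hβ0 : 0 ≤ β₀ := (ha.trans_le hβ₀).le
  suffices H : ∀ j m, N ≤ m + j → ∀ U ∈ setU n, ∀ α ∈ Set.Icc p.αmin p.αmax,
      Acc (fun t s => Step S ρ ε p r s t)
        (.test m (boundSeq S ρ β₀ r m) 0 (fun _ => U) α) by
    have h := H N 0 (by omega) U₀ hU₀ α₀ hα₀
    simpa [initState, boundSeq, hβ₀'] using h
  have hdone : ∀ m β Uhat, Acc (fun t s => Step S ρ ε p r s t) (.done m β Uhat) :=
    fun m β Uhat => Acc.intro _ fun t ht => nomatch ht
  intro j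
  induction j with
  | zero =>
    intro m hm U hU α hα
    refine acc_test hρ ha (alphaRho_le_boundSeq ha hβ₀ hβ₀' hr m) hε (fun Uhat _ => ?_) hU hα
    refine Acc.intro _ fun t ht => ?_
    cases ht with
    | finish => exact hdone _ _ _
    | raise _ _ _ α h hα =>
      exact absurd (Or.inl (boundSeq_eq_of_le hβ0 hr hN (by omega))) h
  | succ j ih =>
    intro m hm U hU α hα
    refine acc_test hρ ha (alphaRho_le_boundSeq ha hβ₀ hβ₀' hr m) hε (fun Uhat hUhat => ?_) hU hα
    refine Acc.intro _ fun t ht => ?_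
    cases ht with
    | finish => exact hdone _ _ _
    | raise _ _ _ α h hα =>
      rw [boundSeq_succ (not_or.1 h).1]
      exact ih (m + 1) (by omega) Uhat hUhat α hα

lemma not_exists_run {s : State n} (hs : Acc (fun t s => Step S ρ ε p r s t) s) :
    ¬ ∃ run : ℕ → State n, run 0 = s ∧ ∀ i, Step S ρ ε p r (run i) (run (i + 1)) := by
  induction hs with
  | intro s _ ih =>
    rintro ⟨run, rfl, hrun⟩
    exact ih (run 1) (hrun 0) ⟨fun i => run (i + 1), rfl, fun i => hrun (i + 1)⟩

lemma exists_done {β₀ : ℝ} {N : ℕ} (hβ₀ : 0 ≤ β₀) (hr : 1 < r) (hN : betaRho S ρ ≤ β₀ * r ^ N)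
    {s : State n} (hs : Acc (fun t s => Step S ρ ε p r s t) s) (hI : Inv S ρ ε p r β₀ N s) :
    ∃ m β Uhat, Relation.ReflTransGen (Step S ρ ε p r) s (.done m β Uhat) := by
  induction hs with
  | intro s _ ih =>
    rcases hI.progress with ⟨m, β, Uhat, rfl⟩ | ⟨t, ht⟩
    · exact ⟨m, β, Uhat, .refl⟩
    · obtain ⟨m, β, Uhat, h⟩ := ih t ht (hI.step hβ₀ hr hN ht)
      exact ⟨m, β, Uhat, h.head ht⟩

/-! ### Bounds on the solutions of the penalized problem -/

lemma quad_le_opNorm (A : Mat n) (v : Fin n → ℝ) : v ⬝ᵥ A *ᵥ v ≤ opNorm A * (v ⬝ᵥ v) := by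
  have h := real_inner_le_norm (WithLp.toLp 2 v)
    (Matrix.toEuclideanCLM (n := Fin n) (𝕜 := ℝ) A (WithLp.toLp 2 v))
  have h1 := (Matrix.toEuclideanCLM (n := Fin n) (𝕜 := ℝ) A).le_opNorm (WithLp.toLp 2 v)
  have h2 : ‖(WithLp.toLp 2 v : EuclideanSpace ℝ (Fin n))‖ ^ 2 = v ⬝ᵥ v := by
    rw [EuclideanSpace.real_norm_sq_eq]
    simp [dotProduct, sq]
  rw [Matrix.inner_toEuclideanCLM] at h
  calc v ⬝ᵥ A *ᵥ v ≤ _ := h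
    _ ≤ ‖(WithLp.toLp 2 v : EuclideanSpace ℝ (Fin n))‖ *
        (opNorm A * ‖(WithLp.toLp 2 v : EuclideanSpace ℝ (Fin n))‖) :=
      mul_le_mul_of_nonneg_left h1 (norm_nonneg _)
    _ = opNorm A * (v ⬝ᵥ v) := by rw [← h2]; ring

lemma alphaRho_pos (hn : 0 < n) (hSρ : (S + diagPart ρ).PosDef) : 0 < alphaRho S ρ := by
  have h := hSρ.diag_pos (i := ⟨0, hn⟩)
  have h1 := quad_le_opNorm S (Pi.single ⟨0, hn⟩ 1)
  have h2 := quad_le_opNorm ρ (Pi.single ⟨0, hn⟩ 1)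
  simp [diagPart] at h h1 h2
  exact one_div_pos.2 (by linarith)

lemma ip_diagPart_le (hρ : ∀ i j, 0 ≤ ρ i j) (X : Mat n) :
    ip (diagPart ρ) X ≤ ∑ i, ∑ j, ρ i j * |X i j| := by
  rw [ip_eq_sum]
  refine Finset.sum_le_sum fun i _ => Finset.sum_le_sum fun j _ => ?_
  by_cases hij : i = j
  · subst hij
    simpa [diagPart] using mul_le_mul_of_nonneg_left (le_abs_self (X i i)) (hρ i i)
  · simpa [diagPart, hij] using mul_nonneg (hρ i j) (abs_nonneg (X i j))

lemma log_sub_mul_le {m t : ℝ} (hm : 0 < m) (ht : 0 < t) :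
    Real.log t - m * t ≤ -1 - Real.log m := by
  have := Real.log_le_sub_one_of_pos (mul_pos hm ht)
  rw [Real.log_mul hm.ne' ht.ne'] at this
  linarith

/-- A point where `log t - m t - c` is nonnegative lies below the largest root of this function. -/
lemma le_sSup_roots {m c t : ℝ} (hm : 0 < m) (ht : 0 < t) (h : c ≤ Real.log t - m * t) :
    t ≤ sSup {t : ℝ | 0 < t ∧ Real.log t - m * t - c = 0} := by
  -- The tangent bound with slope `m / 2` leaves a negative linear term, which bounds the roots.
  have hb : ∀ x : ℝ, 0 < x → Real.log x - m * x ≤ -1 - Real.log (m / 2) - m / 2 * x := by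
    intro x hx
    have := log_sub_mul_le (half_pos hm) hx
    linarith
  set T := max t ((-1 - Real.log (m / 2) - c) / (m / 2)) with hT
  have hTt : t ≤ T := le_max_left _ _
  have hTc : Real.log T - m * T ≤ c := by
    have h1 := hb T (ht.trans_le hTt)
    have h2 : (-1 - Real.log (m / 2) - c) / (m / 2) ≤ T := le_max_right _ _
    rw [div_le_iff₀ (half_pos hm)] at h2
    linarith
  have hcont : ContinuousOn (fun x : ℝ => Real.log x - m * x - c) (Set.Icc t T) := by
    refine ((Real.continuousOn_log.mono fun x hx => ?_).sub (by fun_prop)).sub continuousOn_const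
    exact (ht.trans_le hx.1).ne'
  obtain ⟨x, hx, hx0⟩ := intermediate_value_Icc' hTt hcont
    (show (0 : ℝ) ∈ Set.Icc _ _ from ⟨by linarith, by linarith⟩)
  refine hx.1.trans (le_csSup ⟨(-1 - Real.log (m / 2) - c) / (m / 2), ?_⟩ ⟨ht.trans_le hx.1, hx0⟩)
  rintro y ⟨hy, hy0⟩
  rw [le_div_iff₀ (half_pos hm)]
  have := hb y hy
  linarith

lemma penaltyVal_le_sum (hρ : ∀ i j, 0 ≤ ρ i j) (hSρ : (S + diagPart ρ).PosDef)
    {X : Mat n} (hX : X.PosDef) : penaltyVal S ρ X ≤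
      ∑ i, (Real.log (hX.1.eigenvalues i) - lamMin (S + diagPart ρ) * hX.1.eigenvalues i) := by
  have h1 := ip_diagPart_le hρ X
  have h2 := ip_nonneg (psd_sub_smul_one_of_eigenvalues hSρ.1 (lamMin_le hSρ.1)) hX.posSemidef
  have h3 : ip (1 : Mat n) X = X.trace := by rw [ip, one_mul, Matrix.trace_transpose]
  rw [ip_sub_left, ip_smul_left, ip_add_left, h3] at h2
  rw [Finset.sum_sub_distrib, ← Finset.mul_sum, ← log_det_eq_sum hX]
  have h4 := hX.1.trace_eq_sum_eigenvalues
  simp only [RCLike.ofReal_real_eq_id, id] at h4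
  rw [← h4, penaltyVal]
  linarith

/-- A positive definite matrix whose objective value is at least that of both reference values in
`vartheta` satisfies `X ⪯ β_ρ I`: all but one of the eigenvalue terms `log t - m t` are bounded by
their maximum `-1 - log m`, so that the remaining one is at least `vartheta`. -/
lemma eigenvalues_le_betaRho (hn : 0 < n) (hρ : ∀ i j, 0 ≤ ρ i j) (hSρ : (S + diagPart ρ).PosDef)
    {X : Mat n} (hX : X.PosDef)
    (h : max (penaltyVal S ρ (S + diagPart ρ)⁻¹) (theta S ρ) ≤ penaltyVal S ρ X) (i : Fin n) :
    hX.1.eigenvalues i ≤ betaRho S ρ := by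
  have hm := lamMin_pos hn hSρ
  refine le_sSup_roots hm (hX.eigenvalues_pos i) ?_
  have h1 := penaltyVal_le_sum hρ hSρ hX
  rw [← Finset.add_sum_erase _ _ (Finset.mem_univ i)] at h1
  have h2 := Finset.sum_le_card_nsmul (Finset.univ.erase i)
    (fun i => Real.log (hX.1.eigenvalues i) - lamMin (S + diagPart ρ) * hX.1.eigenvalues i) _
    fun j _ => log_sub_mul_le hm (hX.eigenvalues_pos j)
  rw [Finset.card_erase_of_mem (Finset.mem_univ i), Finset.card_univ, Fintype.card_fin, nsmul_eq_mul,
    Nat.cast_sub hn, Nat.cast_one] at h2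
  rw [vartheta]
  linarith

/-- The reference value `theta` is attained at the multiple of the identity on which the objective
is largest. -/
lemma exists_penaltyVal_eq_theta (hn : 0 < n) (hSρ : (S + diagPart ρ).PosDef) :
    ∃ X : Mat n, X.PosDef ∧ penaltyVal S ρ X = theta S ρ := by
  have hn' : (0 : ℝ) < n := by exact_mod_cast hn
  have : Nonempty (Fin n) := ⟨⟨0, hn⟩⟩
  have hτ : 0 < (S + ρ).trace := by
    have : (S + ρ).trace = (S + diagPart ρ).trace := by simp [Matrix.trace, diagPart]
    rw [this]
    exact hSρ.trace_pos
  set τ := (S + ρ).trace with hτd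
  have hc : 0 < (n : ℝ) / τ := div_pos hn' hτ
  refine ⟨((n : ℝ) / τ) • 1, Matrix.PosDef.one.smul hc, ?_⟩
  have h1 : ip S (((n : ℝ) / τ) • 1) = n / τ * S.trace := by
    rw [ip_smul_right]; simp [ip]
  have h2 : ∑ i, ∑ j, ρ i j * |(((n : ℝ) / τ) • (1 : Mat n)) i j| = n / τ * ρ.trace := by
    simp [Matrix.trace, Matrix.one_apply, apply_ite abs, abs_of_pos hc, Finset.mul_sum,
      mul_comm]
  have h3 : n / τ * S.trace + n / τ * ρ.trace = n := by
    rw [← mul_add, ← Matrix.trace_add, ← hτd]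
    field_simp
  rw [penaltyVal, h1, h2, theta, Matrix.det_smul, Matrix.det_one, mul_one, Fintype.card_fin,
    Real.log_pow, Real.log_div hn'.ne' hτ.ne', ← hτd]
  linarith

lemma quad_add_smul_vecMulVec (X : Mat n) (t : ℝ) (v w : Fin n → ℝ) :
    w ⬝ᵥ (X + t • Matrix.vecMulVec v v) *ᵥ w = w ⬝ᵥ X *ᵥ w + t * (v ⬝ᵥ w) ^ 2 := by
  have : Matrix.vecMulVec v v *ᵥ w = (v ⬝ᵥ w) • v := by
    ext i
    simp [Matrix.mulVec, Matrix.vecMulVec_apply, dotProduct, Finset.sum_mul]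
    exact Finset.sum_congr rfl fun j _ => by ring
  rw [Matrix.add_mulVec, Matrix.smul_mulVec, this, dotProduct_add, dotProduct_smul,
    dotProduct_smul, smul_eq_mul, smul_eq_mul, dotProduct_comm w v]
  ring

lemma dotProduct_sq_le (v w : Fin n → ℝ) : (v ⬝ᵥ w) ^ 2 ≤ (v ⬝ᵥ v) * (w ⬝ᵥ w) := by
  simpa only [dotProduct, sq] using Finset.sum_mul_sq_le_sq_mul_sq Finset.univ v w

/-- Adding `t v vᵀ` with a unit eigenvector `v` of `X` raises `log det` by at least
`t / (lam + t)`. -/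
lemma log_det_add_vecMulVec {X : Mat n} (hX : X.PosDef) {v : Fin n → ℝ} (hv : v ⬝ᵥ v = 1)
    {lam t : ℝ} (hlam : 0 < lam) (ht : 0 < t) (hXv : X *ᵥ v = lam • v) :
    Real.log X.det + t / (lam + t) ≤ Real.log (X + t • Matrix.vecMulVec v v).det := by
  have hV : (t • Matrix.vecMulVec v v).PosSemidef :=
    (Matrix.posSemidef_vecMulVec_self_star v).smul ht.le
  have hY : (X + t • Matrix.vecMulVec v v).PosDef := hX.add_posSemidef hV
  set Y := X + t • Matrix.vecMulVec v v with hYd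
  have hYv : Y *ᵥ v = (lam + t) • v := by
    have : Matrix.vecMulVec v v *ᵥ v = v := by
      ext i
      simp only [Matrix.mulVec, Matrix.vecMulVec_apply, dotProduct, mul_assoc, ← Finset.mul_sum]
      rw [show ∑ j, v j * v j = 1 from hv, mul_one]
    rw [hYd, Matrix.add_mulVec, hXv, Matrix.smul_mulVec, this, add_smul]
  have hinv : Y⁻¹ *ᵥ v = (lam + t)⁻¹ • v := by
    have h1 : Y⁻¹ *ᵥ (Y *ᵥ v) = v := by
      rw [Matrix.mulVec_mulVec, Matrix.nonsing_inv_mul _ hY.det_pos.ne'.isUnit, Matrix.one_mulVec]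
    rw [hYv, Matrix.mulVec_smul] at h1
    rw [← h1, smul_smul, inv_mul_cancel₀ (by positivity), one_smul]
    rw [h1]
  have htr : (Y⁻¹ * X).trace = n - t / (lam + t) := by
    have e : X = Y - t • Matrix.vecMulVec v v := by rw [hYd]; abel
    have e1 : (Y⁻¹ * Matrix.vecMulVec v v).trace = (lam + t)⁻¹ := by
      have := ip_vecMulVec Y⁻¹ v
      rw [ip, Matrix.transpose_vecMulVec, hinv, dotProduct_smul, hv] at this
      simpa using this
    rw [e, mul_sub, Matrix.trace_sub, trace_inv_mul_self hY, Matrix.mul_smul, Matrix.trace_smul, e1,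
      smul_eq_mul, div_eq_mul_inv]
  have h := log_det_le hY hX
  rw [htr] at h
  linarith

lemma penalty_add_vecMulVec_le (hρ : ∀ i j, 0 ≤ ρ i j) (X : Mat n) (v : Fin n → ℝ) {t : ℝ}
    (ht : 0 ≤ t) :
    ip S (X + t • Matrix.vecMulVec v v)
        + ∑ i, ∑ j, ρ i j * |(X + t • Matrix.vecMulVec v v) i j|
      ≤ ip S X + ∑ i, ∑ j, ρ i j * |X i j| + t * ((opNorm S + opNorm ρ) * (v ⬝ᵥ v)) := by
  have h1 : ∑ i, ∑ j, ρ i j * |(X + t • Matrix.vecMulVec v v) i j|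
      ≤ ∑ i, ∑ j, (ρ i j * |X i j| + t * (ρ i j * (|v i| * |v j|))) := by
    refine Finset.sum_le_sum fun i _ => Finset.sum_le_sum fun j _ => ?_
    have : |(X + t • Matrix.vecMulVec v v) i j| ≤ |X i j| + t * (|v i| * |v j|) := by
      refine (abs_add_le _ _).trans_eq ?_
      rw [Matrix.smul_apply, Matrix.vecMulVec_apply, smul_eq_mul, abs_mul, abs_mul, abs_of_nonneg ht]
    nlinarith [hρ i j]
  have h2 : ∑ i, ∑ j, ρ i j * (|v i| * |v j|) = |v| ⬝ᵥ ρ *ᵥ |v| := by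
    rw [← ip_vecMulVec, ip_eq_sum]
    simp [Matrix.vecMulVec_apply]
  have h3 : |v| ⬝ᵥ |v| = v ⬝ᵥ v := by simp [dotProduct]
  have h4 := quad_le_opNorm ρ |v|
  have h5 := quad_le_opNorm S v
  rw [h3] at h4
  simp only [Finset.sum_add_distrib, ← Finset.mul_sum] at h1
  rw [h2] at h1
  rw [ip_add_right, ip_smul_right, ip_vecMulVec]
  have h6 := mul_le_mul_of_nonneg_left (add_le_add h4 h5) ht
  linarith

/-- A maximizer of the penalized objective over a Loewner interval whose upper constraint is
inactive satisfies `α_ρ I ⪯ X`: otherwise a small multiple of `v vᵀ`, for an eigenvector `v` with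
a too small eigenvalue, would increase the objective. -/
lemma alphaRho_le_eigenvalues (hρ : ∀ i j, 0 ≤ ρ i j) {a b b' : ℝ}
    (ha : 0 < a) (hb : b < b') {X : Mat n} (hX : X ∈ loewnerIcc n a b)
    (hmax : ∀ Y ∈ loewnerIcc n a b', penaltyVal S ρ Y ≤ penaltyVal S ρ X) (hXH : X.IsHermitian)
    (i : Fin n) : alphaRho S ρ ≤ hXH.eigenvalues i := by
  by_contra! hlt
  have hXpd := posDef_of_mem ha hX
  set lam := hXH.eigenvalues i with hlam
  have hl0 : 0 < lam := hXpd.eigenvalues_pos i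
  set v : Fin n → ℝ := (hXH.eigenvectorBasis i).ofLp with hv
  have hv1 : v ⬝ᵥ v = 1 := by
    have h := hXH.eigenvectorBasis.orthonormal.1 i
    have h2 := EuclideanSpace.real_norm_sq_eq (hXH.eigenvectorBasis i)
    rw [h] at h2
    simp only [dotProduct, ← sq, hv]
    rw [← h2, one_pow]
  obtain ⟨t, ht0, htb, htl⟩ : ∃ t : ℝ, 0 < t ∧ t ≤ b' - b ∧ lam + t < alphaRho S ρ :=
    ⟨min (b' - b) ((alphaRho S ρ - lam) / 2), lt_min (by linarith) (by linarith), min_le_left _ _,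
      by linarith [min_le_right (b' - b) ((alphaRho S ρ - lam) / 2)]⟩
  have hY : X + t • Matrix.vecMulVec v v ∈ loewnerIcc n a b' := by
    have hvv : (Matrix.vecMulVec v v).IsSymm := Matrix.transpose_vecMulVec v v
    rw [mem_loewnerIcc] at hX ⊢
    refine ⟨hX.1.add (hvv.smul t), fun w => ?_, fun w => ?_⟩ <;>
      rw [quad_add_smul_vecMulVec]
    · have := mul_nonneg ht0.le (sq_nonneg (v ⬝ᵥ w))
      linarith [hX.2.1 w]
    · have h1 := dotProduct_sq_le v w
      rw [hv1, one_mul] at h1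
      have h2 := mul_le_mul htb h1 (sq_nonneg _) (by linarith)
      linarith [hX.2.2 w]
  have h1 := hmax _ hY
  have h2 := log_det_add_vecMulVec hXpd hv1 hl0 ht0 (hXH.mulVec_eigenvectorBasis i)
  have h3 := penalty_add_vecMulVec_le (S := S) hρ X v ht0.le
  rw [hv1, mul_one] at h3
  have h4 : t * (opNorm S + opNorm ρ) = t / alphaRho S ρ := by
    rw [alphaRho, one_div, div_inv_eq_mul]
  have h5 : t / alphaRho S ρ < t / (lam + t) :=
    div_lt_div_of_pos_left ht0 (by linarith) htl
  simp only [penaltyVal] at h1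
  linarith

lemma continuousOn_penaltyVal {a b : ℝ} (ha : 0 < a) :
    ContinuousOn (penaltyVal S ρ) (loewnerIcc n a b) :=
  ((continuousOn_log_det ha).sub (continuous_ip_right S).continuousOn).sub
    (Continuous.continuousOn (by fun_prop))

/-- Every objective value of the penalized problem is matched within `setX S ρ`. The matching
matrix is a maximizer over a Loewner interval that contains the given matrix and the two reference
points of `vartheta`, or rather the best of these three. -/
lemma exists_mem_setX (hn : 0 < n) (hρ : ∀ i j, 0 ≤ ρ i j) (hSρ : (S + diagPart ρ).PosDef)
    {Y : Mat n} (hY : Y.PosDef) : ∃ X ∈ setX S ρ, penaltyVal S ρ Y ≤ penaltyVal S ρ X := by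
  have hα := alphaRho_pos hn hSρ
  obtain ⟨T, hT, hTθ⟩ := exists_penaltyVal_eq_theta hn hSρ
  obtain ⟨W, hW, hWY, hWmax⟩ : ∃ W : Mat n, W.PosDef ∧ penaltyVal S ρ Y ≤ penaltyVal S ρ W ∧
      max (penaltyVal S ρ (S + diagPart ρ)⁻¹) (theta S ρ) ≤ penaltyVal S ρ W := by
    rw [← hTθ]
    rcases le_total (penaltyVal S ρ (S + diagPart ρ)⁻¹) (penaltyVal S ρ T) with h1 | h1
    · rw [max_eq_right h1]
      rcases le_total (penaltyVal S ρ Y) (penaltyVal S ρ T) with h2 | h2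
      · exact ⟨T, hT, h2, le_rfl⟩
      · exact ⟨Y, hY, le_rfl, h2⟩
    · rw [max_eq_left h1]
      rcases le_total (penaltyVal S ρ Y) (penaltyVal S ρ (S + diagPart ρ)⁻¹) with h2 | h2
      · exact ⟨_, hSρ.inv, h2, le_rfl⟩
      · exact ⟨Y, hY, le_rfl, h2⟩
  have hup : ∀ {Z : Mat n} (hZ : Z.PosDef), penaltyVal S ρ W ≤ penaltyVal S ρ Z →
      (betaRho S ρ • (1 : Mat n) - Z).PosSemidef := fun {Z} hZ hWZ =>
    psd_smul_one_sub_of_eigenvalues hZ.1 (eigenvalues_le_betaRho hn hρ hSρ hZ (hWmax.trans hWZ))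
  have ha := lamMin_pos hn hW
  have hW' : W ∈ loewnerIcc n (lamMin W) (betaRho S ρ) :=
    ⟨isSymm_of_posDef hW, psd_sub_smul_one_of_eigenvalues hW.1 (lamMin_le hW.1), hup hW le_rfl⟩
  have hW'' :=
    loewnerIcc_subset le_rfl (le_add_of_nonneg_right zero_le_one : _ ≤ betaRho S ρ + 1) hW'
  have hab : lamMin W ≤ betaRho S ρ + 1 := by
    have h1 := eigenvalues_le_betaRho hn hρ hSρ hW hWmax ⟨0, hn⟩
    have h2 := lamMin_le hW.1 ⟨0, hn⟩
    linarith
  obtain ⟨X, hX, hmax⟩ := (isCompact_loewnerIcc ha.le hab).exists_isMaxOn ⟨W, hW''⟩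
    (continuousOn_penaltyVal (S := S) (ρ := ρ) ha)
  have hXpd := posDef_of_mem ha hX
  have hXW : penaltyVal S ρ W ≤ penaltyVal S ρ X := hmax hW''
  have hXu := hup hXpd hXW
  refine ⟨X, ⟨hX.1, psd_sub_smul_one_of_eigenvalues hXpd.1 ?_, hXu⟩, hWY.trans hXW⟩
  exact alphaRho_le_eigenvalues hρ ha (lt_add_one _) ⟨hX.1, hX.2.1, hXu⟩
    (fun Y hY => hmax hY) hXpd.1

/-! ### Optimality of the returned point -/

/-- A maximizer of the concave function `φ(·, U)` over a smaller box at which the upper constraint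
is inactive is a maximizer over the larger box. -/
lemma IsInnerSol.of_lamMax_lt (ha : 0 < alphaRho S ρ) {β β' : ℝ} (hβ : β ≤ β') {U X : Mat n}
    (hX : IsInnerSol S ρ β U X) (hlt : lamMax X < β) : IsInnerSol S ρ β' U X := by
  refine ⟨loewnerIcc_subset le_rfl hβ hX.1, fun Y hY => ?_⟩
  have hXpd : X.PosDef := posDef_of_mem_box ha hX.1
  have hYpd : Y.PosDef := posDef_of_mem_box ha hY
  set l := lamMax X
  have hXl : X ∈ loewnerIcc n (alphaRho S ρ) l :=
    ⟨hX.1.1, hX.1.2.1, psd_smul_one_sub_of_eigenvalues hXpd.1 (le_lamMax hXpd.1)⟩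
  have hpos : 0 < β' - l := by linarith
  -- The factor 1/2 keeps `t` below 1 when `β = β'`.
  obtain ⟨t, ht0, ht1, htb⟩ : ∃ t : ℝ, 0 < t ∧ t < 1 ∧ t * (β' - l) ≤ β - l := by
    refine ⟨(β - l) / (2 * (β' - l)), div_pos (by linarith) (by linarith), ?_, ?_⟩
    · rw [div_lt_one (by linarith)]; linarith
    · rw [div_mul_eq_mul_div, div_le_iff₀ (by linarith)]
      nlinarith
  have hZ : (1 - t) • X + t • Y ∈ box S ρ β := by
    have h1 := loewnerIcc_convex (loewnerIcc_subset le_rfl (by linarith : l ≤ β') hXl) hY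
      (sub_nonneg.2 ht1.le) ht0.le (sub_add_cancel 1 t)
    refine mem_loewnerIcc.2 ⟨h1.1, (mem_loewnerIcc.1 h1).2.1, fun v => ?_⟩
    have hv := dotProduct_self_nonneg' v
    have h2 := mul_le_mul_of_nonneg_left ((mem_loewnerIcc.1 hXl).2.2 v) (sub_nonneg.2 ht1.le)
    have h3 := mul_le_mul_of_nonneg_left ((mem_loewnerIcc.1 hY).2.2 v) ht0.le
    have h4 := mul_le_mul_of_nonneg_right htb hv
    rw [Matrix.add_mulVec, Matrix.smul_mulVec, Matrix.smul_mulVec, dotProduct_add, dotProduct_smul,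
      dotProduct_smul, smul_eq_mul, smul_eq_mul]
    linarith
  have h1 := hX.2 _ hZ
  have h2 := log_det_concave hXpd hYpd (sub_pos.2 ht1) ht0 (sub_add_cancel 1 t)
  simp only [phi, ip_add_right, ip_smul_right] at h1 ⊢
  refine le_of_mul_le_mul_left ?_ ht0
  linarith

/-- A feasible `Uhat` with duality gap at most `ε` is `ε`-optimal for the dual problem, and its
inner solution is so for the primal and the penalized problem, if the bound `β` is either the largest
one or not active at the inner solution. -/
theorem optimal_of_done (hn : 0 < n) (hρ : ∀ i j, 0 ≤ ρ i j) (hSρ : (S + diagPart ρ).PosDef)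
    {ε β : ℝ} (hβ : alphaRho S ρ ≤ β) (hβ' : β ≤ betaRho S ρ) {Uhat : Mat n}
    (hU : Uhat ∈ setU n) (hgap : gBeta S ρ β Uhat - fRho S ρ (Xopt S ρ β Uhat) ≤ ε)
    (hfin : β = betaRho S ρ ∨ lamMax (Xopt S ρ β Uhat) < β) :
    IsInnerSol S ρ β Uhat (Xopt S ρ β Uhat) ∧
      IsEpsMin (gRho S ρ) (setU n) ε Uhat ∧
      IsEpsMax (fun X => (fRho S ρ X : EReal)) (setX S ρ) ε (Xopt S ρ β Uhat) ∧
      IsEpsMax (penaltyObj S ρ) {X | X.PosSemidef} ε (Xopt S ρ β Uhat) ∧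
      (β = betaRho S ρ ∨ lamMax (Xopt S ρ β Uhat) < β) ∧
      gRho S ρ Uhat = gBeta S ρ β Uhat := by
  have ha := alphaRho_pos hn hSρ
  have hX := xopt_isInnerSol ha hβ Uhat
  set X := Xopt S ρ β Uhat
  have hX' : IsInnerSol S ρ (betaRho S ρ) Uhat X := by
    rcases hfin with h | h
    · rwa [h] at hX
    · exact hX.of_lamMax_lt ha hβ' h
  have hg : gRho S ρ Uhat = gBeta S ρ β Uhat :=
    (gBeta_eq_of_isInnerSol hX').trans (gBeta_eq_of_isInnerSol hX).symm
  have hXpd : X.PosDef := posDef_of_mem_box ha hX.1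
  have hdual : ∀ Y ∈ setX S ρ, ∀ V ∈ setU n, penaltyVal S ρ Y ≤ gRho S ρ V := fun Y hY V hV =>
    (penaltyVal_le_phi hρ Y hV).trans (phi_le_gBeta ha (hβ.trans hβ') hY V)
  rw [← hg, fRho_eq hρ hX.1.1] at hgap
  refine ⟨hX, ⟨hU, fun V hV => ?_⟩, ⟨hX'.1, fun Y hY => ?_⟩, ⟨hXpd.posSemidef, fun Y _ => ?_⟩, hfin,
    hg⟩
  · linarith [hdual X hX'.1 V hV]
  · have := hdual Y hY Uhat hU
    simp only [fRho_eq hρ hY.1, fRho_eq hρ hX.1.1]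
    exact_mod_cast (by linarith : penaltyVal S ρ Y ≤ penaltyVal S ρ X + ε)
  · by_cases hYpd : Y.PosDef
    · obtain ⟨Z, hZ, hYZ⟩ := exists_mem_setX hn hρ hSρ hYpd
      have := hdual Z hZ Uhat hU
      rw [penaltyObj, penaltyObj, if_pos hYpd, if_pos hXpd]
      exact_mod_cast (by linarith : penaltyVal S ρ Y ≤ penaltyVal S ρ X + ε)
    · rw [penaltyObj, if_neg hYpd]
      exact bot_le

end ASPG

theorem mainTheorem2 {n : ℕ} (hn : 0 < n) (S ρ : ASPG.Mat n)
    (hS : S.PosSemidef) (hρsymm : ρ.IsSymm) (hρ : ∀ i j, 0 ≤ ρ i j)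
    (hSρ : (S + ASPG.diagPart ρ).PosDef)
    (ε : ℝ) (hε : 0 < ε) (p : ASPG.SPGParams) (r : ℝ) (hr : 1 < r)
    (β₀ : ℝ) (hβ₀ : ASPG.alphaRho S ρ ≤ β₀) (hβ₀' : β₀ ≤ ASPG.betaRho S ρ)
    (U₀ : ASPG.Mat n) (hU₀ : U₀ ∈ ASPG.setU n)
    (α₀ : ℝ) (hα₀ : α₀ ∈ Set.Icc p.αmin p.αmax) :
    -- the method never gets stuck: it can continue until it has terminated
    (∀ s, ASPG.Reachable S ρ ε p r β₀ U₀ α₀ s →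
      (∃ m β Uhat, s = .done m β Uhat) ∨ ∃ t, ASPG.Step S ρ ε p r s t) ∧
    -- there is no infinite execution, whatever choices the method makes
    (¬ ∃ run : ℕ → ASPG.State n, run 0 = ASPG.initState β₀ U₀ α₀ ∧
      ∀ i, ASPG.Step S ρ ε p r (run i) (run (i + 1))) ∧
    -- some execution does terminate
    (∃ m β Uhat, ASPG.Reachable S ρ ε p r β₀ U₀ α₀ (.done m β Uhat)) ∧
    -- the bound is raised only finitely often
    (∃ N : ℕ, ∀ s, ASPG.Reachable S ρ ε p r β₀ U₀ α₀ s → s.raises ≤ N) ∧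
    -- what holds whenever it has terminated
    (∀ m β Uhat, ASPG.Reachable S ρ ε p r β₀ U₀ α₀ (.done m β Uhat) →
      ASPG.IsInnerSol S ρ β Uhat (ASPG.Xopt S ρ β Uhat) ∧
      ASPG.IsEpsMin (ASPG.gRho S ρ) (ASPG.setU n) ε Uhat ∧
      ASPG.IsEpsMax (fun X => (ASPG.fRho S ρ X : EReal)) (ASPG.setX S ρ) ε
        (ASPG.Xopt S ρ β Uhat) ∧
      ASPG.IsEpsMax (ASPG.penaltyObj S ρ) {X | X.PosSemidef} ε (ASPG.Xopt S ρ β Uhat) ∧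
      (β = ASPG.betaRho S ρ ∨ ASPG.lamMax (ASPG.Xopt S ρ β Uhat) < β) ∧
      ASPG.gRho S ρ Uhat = ASPG.gBeta S ρ β Uhat) := by
  have ha := ASPG.alphaRho_pos hn hSρ
  have hβ0 : 0 < β₀ := ha.trans_le hβ₀
  obtain ⟨N, hN'⟩ := pow_unbounded_of_one_lt (ASPG.betaRho S ρ / β₀) hr
  have hN : ASPG.betaRho S ρ ≤ β₀ * r ^ N := by
    rw [div_lt_iff₀ hβ0, mul_comm] at hN'
    exact hN'.le
  have hinv : ∀ s, ASPG.Reachable S ρ ε p r β₀ U₀ α₀ s → ASPG.Inv S ρ ε p r β₀ N s :=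
    fun s hs => ASPG.Inv.reachable hβ0.le hr hN hβ₀' hU₀ hα₀ hs
  have hacc := ASPG.acc_initState (p := p) hρ ha hε hr hβ₀ hβ₀' hN hU₀ hα₀
  refine ⟨fun s hs => (hinv s hs).progress, ASPG.not_exists_run hacc,
    ASPG.exists_done hβ0.le hr hN hacc (hinv _ .refl), ⟨N, fun s hs => (hinv s hs).raises_le⟩,
    fun m β Uhat hs => ?_⟩
  obtain ⟨rfl, -, hU, hgap, hfin⟩ := hinv _ hs
  exact ASPG.optimal_of_done hn hρ hSρ (ASPG.alphaRho_le_boundSeq ha hβ₀ hβ₀' hr m)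
    (min_le_right _ _) hU hgap hfin
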